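/- A lattice polytope in $\mathbb{R}^d$ is the convex hull of a finite set of points with integer coordinates, and a lattice $(d,k)$-polytope is a lattice polytope in $\mathbb{R}^d$ (not necessarily of full dimension) all of whose vertices belong to $\{0,1,\dots,k\}^d$. The diameter $\delta(P)$ of a polytope $P$ is the diameter of its graph, that is, of the graph formed by the vertices and the edges of $P$. Let $\delta(d,k)$ be the largest possible diameter of a lattice $(d,k)$-polytope. Then, for all integers $d\geq 0$ and $k\geq 3$, $$\delta(d,k)\leq kd-\left\lceil\frac{2d}{3}\right\rceil.$$ -/

import Mathlib

/-- A lattice polytope in `ℝ^d`: the convex hull of a finite set of points with integer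
coordinates. -/
def IsLatticePolytope {d : ℕ} (P : Set (Fin d → ℝ)) : Prop :=
  ∃ S : Finset (Fin d → ℤ), P = convexHull ℝ ((fun z i => (z i : ℝ)) '' (S : Set (Fin d → ℤ)))

/-- A lattice `(d,k)`-polytope: a lattice polytope in `ℝ^d` all of whose vertices
belong to `{0, 1, …, k}^d`. -/
def IsLatticeDKPolytope (d k : ℕ) (P : Set (Fin d → ℝ)) : Prop :=
  IsLatticePolytope P ∧
    ∀ v ∈ P.extremePoints ℝ, ∃ z : Fin d → ℕ, (∀ i, z i ≤ k) ∧ v = fun i => (z i : ℝ)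

/-- The graph of a polytope `P`: its vertices are the vertices (extreme points) of `P`, and two
distinct vertices are adjacent when the segment between them is an edge (a face of dimension one)
of `P`. The faces of a polytope are its convex extreme subsets. -/
def polytopeGraph {d : ℕ} (P : Set (Fin d → ℝ)) : SimpleGraph (P.extremePoints ℝ) where
  Adj u v := u ≠ v ∧ IsExtreme ℝ P (segment ℝ (u : Fin d → ℝ) v)
  symm := ⟨fun u v h => ⟨h.1.symm, by rw [segment_symm]; exact h.2⟩⟩
  loopless := ⟨fun _ h => h.1 rfl⟩

/-- The diameter `δ(P)` of a polytope: the diameter of its graph, as an extended natural number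
(it would be `⊤` if the graph were disconnected). -/
noncomputable def polytopeDiam {d : ℕ} (P : Set (Fin d → ℝ)) : ℕ∞ :=
  (polytopeGraph P).ediam

/-- `δ(d,k)`: the largest diameter of a lattice `(d,k)`-polytope, as the supremum in `ℕ∞`
(if it is finite, then it is attained). -/
noncomputable def latticePolytopeDiam (d k : ℕ) : ℕ∞ :=
  ⨆ (P : Set (Fin d → ℝ)) (_ : IsLatticeDKPolytope d k P), polytopeDiam P

/-!
Let `B n = k n - ⌈2 n / 3⌉`. The bound is proved by induction on the dimension, for polytopes with
vertices in `{0, …, k}^d` on which a set `J` of `n` coordinates determines the others. It satisfies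
`B n ≥ B (n - 1) + k - 1`, `B n ≥ B (n - 2) + 2 k - 2` and `B n ≥ B (n - 3) + 3 k - 2`.

If `L` is an integral functional, the simplex method reaches the face of `P` where `L` is least
within `L x - min L` steps (`IsPolytope.exists_reach_min`). Take for `L` the sum of the distances to
one, two or three facets of the cube `[0, k]^d` in different directions. Descending from both
vertices `u` and `v` to the face and using the induction hypothesis there shows that, if `u` and `v`
violate the bound, then `u` and `v` are opposite, all facets of the cube meet `P`, and walks from
`u` and `v` that descend on `L` cannot save a step (one facet), or save at most one step altogether
(two or three facets), in comparison with one unit of descent per step; see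
`IsBadPair.le_one_side`, `IsBadPair.exists_le_two_sides` and `IsBadPair.le_three_sides`.

On the other hand a vertex at distance at least two from a facet does save a step: two consecutive
steps towards the facet are not collinear, so they also move towards another facet
(`IsBadPair.exists_saves`). If both `u` and `v` save steps towards the same facet, these savings add
up to two, unless the second facets involved are opposite; in that case convexity, applied in a
plane section of `P`, puts both `u` and `v` at distance one from the same facet, so that `k = 2`
(`IsBadPair.not_saves_and_saves`).

So `u` and `v` never save towards the same facet. As `k ≥ 3`, this puts `u` within distance one of
the boundary in every direction, with only axis-parallel edges towards the near facets. Let `z_i` be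
the distance to the near facet in the direction `i`. Then a functional `z_i - ∑ z_l` is maximal on
`P` at `u` or at a neighbor of `u`, with value at most one. But a shortest walk from `u` to the far
facet ends at a vertex with `z_i = k` and, since it saves at most one step, `∑ z_l ≤ 1`
(`IsBadPair.false_of_local_max`). This contradicts `k ≥ 3`.
-/

/-! ### Polytopes, their faces and their edges -/

section Polytopes

variable {E : Type*} [NormedAddCommGroup E] [NormedSpace ℝ E]

/-- A polytope, described intrinsically: a compact convex set with finitely many extreme points. -/
structure IsPolytope (P : Set E) : Prop where
  isCompact : IsCompact P
  convex : Convex ℝ P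
  finite : (P.extremePoints ℝ).Finite

theorem IsPolytope.convexHull_extremePoints {P : Set E} (hP : IsPolytope P) :
    convexHull ℝ (P.extremePoints ℝ) = P := by
  have h := closure_convexHull_extremePoints hP.isCompact hP.convex
  rwa [(hP.finite.isCompact_convexHull ℝ).isClosed.closure_eq] at h

/-- A lower bound for a linear functional on the vertices is a lower bound on the polytope. -/
theorem IsPolytope.le_of_extremePoints {P : Set E} (hP : IsPolytope P) {L : E →L[ℝ] ℝ} {γ : ℝ}
    (h : ∀ x ∈ P.extremePoints ℝ, γ ≤ L x) : ∀ x ∈ P, γ ≤ L x := by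
  have hc : Convex ℝ {x | γ ≤ L x} := convex_halfSpace_ge L.toLinearMap.isLinear γ
  intro x hx
  rw [← hP.convexHull_extremePoints] at hx
  exact convexHull_min h hc hx

/-- The part of `P` where `L` takes the value `γ`; a face of `P` when `γ` is the minimum of `L`
on `P`. -/
def levelFace (P : Set E) (L : E →L[ℝ] ℝ) (γ : ℝ) : Set E := {x ∈ P | L x = γ}

theorem isExtreme_levelFace {P : Set E} {L : E →L[ℝ] ℝ} {γ : ℝ} (h : ∀ x ∈ P, γ ≤ L x) :
    IsExtreme ℝ P (levelFace P L γ) := by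
  refine ⟨fun x hx => hx.1, ?_⟩
  rintro x hx y hy z ⟨-, hz⟩ ⟨a, b, ha, hb, hab, rfl⟩
  refine ⟨hx, le_antisymm ?_ (h x hx)⟩
  have hy' := h y hy
  simp only [map_add, map_smul, smul_eq_mul] at hz
  by_contra hlt
  push Not at hlt
  have h1 : a * γ < a * L x := mul_lt_mul_of_pos_left hlt ha
  have h2 : b * γ ≤ b * L y := mul_le_mul_of_nonneg_left hy' hb.le
  have h3 : a * γ + b * γ = γ := by rw [← add_mul, hab, one_mul]
  linarith

theorem IsPolytope.levelFace {P : Set E} (hP : IsPolytope P) {L : E →L[ℝ] ℝ} {γ : ℝ}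
    (h : ∀ x ∈ P, γ ≤ L x) : IsPolytope (levelFace P L γ) where
  isCompact := hP.isCompact.inter_right (isClosed_eq L.continuous continuous_const)
  convex := hP.convex.inter (convex_hyperplane L.toLinearMap.isLinear γ)
  finite := hP.finite.subset (isExtreme_levelFace h).extremePoints_subset_extremePoints

/-- `x` and `y` are the two ends of an edge of `P`. -/
structure IsEdge (P : Set E) (x y : E) : Prop where
  left_mem : x ∈ P.extremePoints ℝ
  right_mem : y ∈ P.extremePoints ℝ
  ne : x ≠ y
  isExtreme : IsExtreme ℝ P (segment ℝ x y)

theorem IsEdge.symm {P : Set E} {x y : E} (h : IsEdge P x y) : IsEdge P y x :=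
  ⟨h.right_mem, h.left_mem, h.ne.symm, by rw [segment_symm]; exact h.isExtreme⟩

theorem IsEdge.of_isExtreme {P F : Set E} (hF : IsExtreme ℝ P F) {x y : E} (h : IsEdge F x y) :
    IsEdge P x y :=
  ⟨hF.extremePoints_subset_extremePoints h.left_mem,
    hF.extremePoints_subset_extremePoints h.right_mem, h.ne, hF.trans h.isExtreme⟩

/-- A vertex of a polytope is the unique maximizer of some linear functional. -/
theorem IsPolytope.exists_lt_of_mem_extremePoints {P : Set E} (hP : IsPolytope P) {u : E}
    (hu : u ∈ P.extremePoints ℝ) :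
    ∃ f : E →L[ℝ] ℝ, ∀ q ∈ P.extremePoints ℝ, q ≠ u → f q < f u := by
  have hfin : (P.extremePoints ℝ \ {u}).Finite := hP.finite.subset Set.sdiff_subset
  have hnot : u ∉ convexHull ℝ (P.extremePoints ℝ \ {u}) := by
    intro h
    have h1 := (hP.convex.mem_extremePoints_iff_mem_sdiff_convexHull_sdiff.1 hu).2
    exact h1 (convexHull_mono (Set.sdiff_subset_sdiff_left extremePoints_subset) h)
  obtain ⟨f, α, h1, h2⟩ := geometric_hahn_banach_closed_point
    (convex_convexHull ℝ _) (hfin.isCompact_convexHull ℝ).isClosed hnot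
  exact ⟨f, fun q hq hne => (h1 q (subset_convexHull ℝ _ ⟨hq, hne⟩)).trans h2⟩

/-- Tilting the functional `f` that exposes the vertex `u` by a multiple of `c` until another
vertex is reached. The multiple is the largest slope `(c u - c q) / (f u - f q)`. -/
theorem IsPolytope.exists_tilt {P : Set E} (hP : IsPolytope P) {u : E} {f c : E →L[ℝ] ℝ}
    (hf : ∀ q ∈ P.extremePoints ℝ, q ≠ u → f q < f u)
    (hne : ∃ q ∈ P.extremePoints ℝ, q ≠ u) :
    ∃ r : ℝ, (∀ q ∈ P.extremePoints ℝ, q ≠ u → c u - c q ≤ r * (f u - f q)) ∧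
      ∃ q ∈ P.extremePoints ℝ, q ≠ u ∧ c u - c q = r * (f u - f q) := by
  obtain ⟨q0, hq0, hq0u⟩ := hne
  have hfin : (P.extremePoints ℝ \ {u}).Finite := hP.finite.subset Set.sdiff_subset
  obtain ⟨q, hq, hmax⟩ := hfin.exists_maximalFor (fun q => (c u - c q) / (f u - f q)) _
    ⟨q0, hq0, hq0u⟩
  have hpos : ∀ q ∈ P.extremePoints ℝ, q ≠ u → 0 < f u - f q := fun q hq h => by
    linarith [hf q hq h]
  refine ⟨(c u - c q) / (f u - f q), fun p hp hpu => ?_, q, hq.1, hq.2, ?_⟩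
  · rw [← div_le_iff₀ (hpos p hp hpu)]
    by_contra hcon
    push Not at hcon
    exact absurd (hmax ⟨hp, hpu⟩ hcon.le) (not_le.2 hcon)
  · rw [div_mul_cancel₀ _ (hpos q hq.1 hq.2).ne']

/-- A vertex of a polytope with at least two vertices is the end of an edge. -/
theorem IsPolytope.exists_isEdge {P : Set E} (hP : IsPolytope P) {u : E}
    (hu : u ∈ P.extremePoints ℝ) (hne : ∃ q ∈ P.extremePoints ℝ, q ≠ u) :
    ∃ w, IsEdge P u w := by
  induction hn : (P.extremePoints ℝ).ncard using Nat.strong_induction_on generalizing P with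
  | _ n ih =>
  subst hn
  obtain ⟨q1, hq1, hq1u⟩ := hne
  by_cases h2 : ∀ q ∈ P.extremePoints ℝ, q = u ∨ q = q1
  · refine ⟨q1, hu, hq1, hq1u.symm, ?_⟩
    have hext : P.extremePoints ℝ = {u, q1} := by
      ext q
      constructor
      · exact fun hq => h2 q hq
      · rintro (rfl | rfl) <;> assumption
    have h := hP.convexHull_extremePoints
    rw [hext, convexHull_pair] at h
    rw [h]
  · push Not at h2
    obtain ⟨q2, hq2, hq2u, hq21⟩ := h2
    obtain ⟨f, hf⟩ := hP.exists_lt_of_mem_extremePoints hu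
    have hs1 : 0 < f u - f q1 := by linarith [hf q1 hq1 hq1u]
    have hs2 : 0 < f u - f q2 := by linarith [hf q2 hq2 hq2u]
    -- `z` vanishes exactly when `u`, `q1`, `q2` are collinear
    set z : E := (f u - f q2) • (q1 - u) - (f u - f q1) • (q2 - u) with hz
    have hz0 : z ≠ 0 := by
      intro h0
      have hcol : (f u - f q2) • (q1 - u) = (f u - f q1) • (q2 - u) := sub_eq_zero.1 h0
      -- of two vertices on the same ray from `u`, the nearer one is not extreme
      have key : ∀ p q : E, p ∈ P.extremePoints ℝ → q ∈ P.extremePoints ℝ → q ≠ u →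
          ∀ s t : ℝ, 0 < s → s < t → t • (p - u) = s • (q - u) → False := by
        intro p q hp hq hqu s t hs hst h
        have ht : 0 < t := hs.trans hst
        have hpe : p = (1 - s / t) • u + (s / t) • q := by
          have h3 : p - u = (s / t) • (q - u) := by
            rw [div_eq_inv_mul, mul_smul, ← h, smul_smul, inv_mul_cancel₀ ht.ne', one_smul]
          rw [sub_smul, one_smul]
          rw [smul_sub] at h3
          rw [← sub_add_cancel p u, h3]
          abel
        have hmem : p ∈ openSegment ℝ u q :=
          ⟨1 - s / t, s / t, by rw [sub_pos, div_lt_one ht]; exact hst, div_pos hs ht, by ring,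
            hpe.symm⟩
        have hpq := (mem_extremePoints.1 hp).2 u hu.1 q hq.1 hmem
        exact hqu (hpq.2.trans hpq.1.symm)
      rcases lt_trichotomy (f u - f q1) (f u - f q2) with h | h | h
      · exact key q1 q2 hq1 hq2 hq2u _ _ hs1 h hcol
      · rw [h] at hcol
        exact hq21 (sub_left_injective (smul_right_injective E hs2.ne' hcol)).symm
      · exact key q2 q1 hq2 hq1 hq1u _ _ hs2 h hcol.symm
    obtain ⟨c, hc⟩ := geometric_hahn_banach_point_point hz0
    rw [map_zero] at hc
    obtain ⟨r, hr, q, hq, hqu, hqr⟩ := hP.exists_tilt (c := c) hf ⟨q1, hq1, hq1u⟩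
    have hL : ∀ x, (r • (-f) + c) x = -(r * f x) + c x := fun x => by simp
    have hmin : ∀ x ∈ P, (r • (-f) + c) u ≤ (r • (-f) + c) x := by
      refine hP.le_of_extremePoints fun x hx => ?_
      by_cases hxu : x = u
      · rw [hxu]
      · have := hr x hx hxu
        rw [hL, hL]; linarith
    set G := _root_.levelFace P (r • (-f) + c) ((r • (-f) + c) u) with hG
    have hGe : IsExtreme ℝ P G := isExtreme_levelFace hmin
    have hGp : IsPolytope G := hP.levelFace hmin
    have hGext := hGe.extremePoints_eq
    have huG : u ∈ G.extremePoints ℝ := by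
      rw [hGext]; exact ⟨⟨hu.1, rfl⟩, hu⟩
    have hqG : q ∈ G.extremePoints ℝ := by
      rw [hGext]
      refine ⟨⟨hq.1, ?_⟩, hq⟩
      rw [hL, hL]; linarith
    have hlt : (G.extremePoints ℝ).ncard < (P.extremePoints ℝ).ncard := by
      refine Set.ncard_lt_ncard ⟨hGe.extremePoints_subset_extremePoints, fun hsub => ?_⟩ hP.finite
      have e1 := (extremePoints_subset (hsub hq1)).2
      have e2 := (extremePoints_subset (hsub hq2)).2
      rw [hL, hL] at e1 e2
      have hcz : c z = (f u - f q2) * (c q1 - c u) - (f u - f q1) * (c q2 - c u) := by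
        simp [hz]
      have e1' : c q1 - c u = r * (f q1 - f u) := by linarith
      have e2' : c q2 - c u = r * (f q2 - f u) := by linarith
      rw [e1', e2'] at hcz
      have : c z = 0 := by rw [hcz]; ring
      linarith
    obtain ⟨w, hw⟩ := ih _ hlt hGp huG ⟨q, hqG, hqu⟩ rfl
    exact ⟨w, hw.of_isExtreme hGe⟩

/-- A vertex that does not minimize `c` has a neighbor with a smaller value of `c`. -/
theorem IsPolytope.exists_isEdge_lt {P : Set E} (hP : IsPolytope P) {u : E}
    (hu : u ∈ P.extremePoints ℝ) {c : E →L[ℝ] ℝ} {p : E} (hp : p ∈ P) (hpu : c p < c u) :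
    ∃ w, IsEdge P u w ∧ c w < c u := by
  have hq0 : ∃ q ∈ P.extremePoints ℝ, c q < c u := by
    by_contra hcon
    push Not at hcon
    exact absurd (hP.le_of_extremePoints hcon p hp) (not_le.2 hpu)
  obtain ⟨q0, hq0, hq0u⟩ := hq0
  have hne : q0 ≠ u := by rintro rfl; exact lt_irrefl _ hq0u
  obtain ⟨f, hf⟩ := hP.exists_lt_of_mem_extremePoints hu
  obtain ⟨r, hr, q, hq, hqu, hqr⟩ := hP.exists_tilt (c := c) hf ⟨q0, hq0, hne⟩
  have hrpos : 0 < r := by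
    have h1 := hr q0 hq0 hne
    have h2 := hf q0 hq0 hne
    by_contra hcon
    push Not at hcon
    have : r * (f u - f q0) ≤ 0 := mul_nonpos_of_nonpos_of_nonneg hcon (by linarith)
    linarith
  have hL : ∀ x, (r • (-f) + c) x = -(r * f x) + c x := fun x => by simp
  have hmin : ∀ x ∈ P, (r • (-f) + c) u ≤ (r • (-f) + c) x := by
    refine hP.le_of_extremePoints fun x hx => ?_
    by_cases hxu : x = u
    · rw [hxu]
    · have := hr x hx hxu
      rw [hL, hL]; linarith
  set G := _root_.levelFace P (r • (-f) + c) ((r • (-f) + c) u) with hG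
  have hGe : IsExtreme ℝ P G := isExtreme_levelFace hmin
  have hGext := hGe.extremePoints_eq
  have huG : u ∈ G.extremePoints ℝ := by
    rw [hGext]; exact ⟨⟨hu.1, rfl⟩, hu⟩
  have hqG : q ∈ G.extremePoints ℝ := by
    rw [hGext]
    refine ⟨⟨hq.1, ?_⟩, hq⟩
    rw [hL, hL]; linarith
  obtain ⟨w, hw⟩ := (hP.levelFace hmin).exists_isEdge huG ⟨q, hqG, hqu⟩
  refine ⟨w, hw.of_isExtreme hGe, ?_⟩
  have e := (extremePoints_subset hw.right_mem).2
  have hwf := hf w (hGe.extremePoints_subset_extremePoints hw.right_mem) hw.ne.symm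
  rw [hL, hL] at e
  have : 0 < r * (f u - f w) := mul_pos hrpos (by linarith)
  linarith

/-- `Reach P n x y`: the vertices `x` and `y` of `P` are joined by a path of at most `n` edges
of `P`. -/
inductive Reach (P : Set E) : ℕ → E → E → Prop
  | refl (n : ℕ) {x : E} (hx : x ∈ P.extremePoints ℝ) : Reach P n x x
  | step {n : ℕ} {x y z : E} (h : IsEdge P x y) (h' : Reach P n y z) : Reach P (n + 1) x z

namespace Reach

variable {P : Set E} {m n : ℕ} {x y z : E}

theorem right_mem (h : Reach P n x y) : y ∈ P.extremePoints ℝ := by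
  induction h with
  | refl _ hx => exact hx
  | step _ _ ih => exact ih

theorem mono (h : Reach P m x y) (hmn : m ≤ n) : Reach P n x y := by
  induction h generalizing n with
  | refl _ hx => exact .refl n hx
  | step h _ ih =>
    obtain ⟨n, rfl⟩ := Nat.exists_eq_add_one_of_ne_zero (n := n) (by omega)
    exact .step h (ih (by omega))

theorem trans (h : Reach P m x y) (h' : Reach P n y z) : Reach P (m + n) x z := by
  induction h with
  | refl _ hx => exact h'.mono (by omega)
  | @step k _ _ _ h _ ih => exact (Reach.step h (ih h')).mono (by omega)

theorem of_isEdge (h : IsEdge P x y) : Reach P 1 x y := .step h (.refl 0 h.right_mem)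

theorem symm (h : Reach P n x y) : Reach P n y x := by
  induction h with
  | refl n hx => exact .refl n hx
  | step h _ ih => exact ih.trans (of_isEdge h.symm)

theorem of_isExtreme {F : Set E} (hF : IsExtreme ℝ P F) (h : Reach F n x y) : Reach P n x y := by
  induction h with
  | refl n hx => exact .refl n (hF.extremePoints_subset_extremePoints hx)
  | step h _ ih => exact .step (h.of_isExtreme hF) ih

end Reach

/-- The simplex method: if `L` takes values differing by integers on the vertices of `P`, then the
face where `L` is least is reached within `L x - min L` steps. -/
theorem IsPolytope.exists_reach_min {P : Set E} (hP : IsPolytope P) {L : E →L[ℝ] ℝ}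
    (hL : ∀ x ∈ P.extremePoints ℝ, ∀ y ∈ P.extremePoints ℝ, ∃ z : ℤ, L x - L y = z)
    {p : E} (hp : p ∈ P.extremePoints ℝ) (hmin : ∀ q ∈ P, L p ≤ L q)
    {x : E} (hx : x ∈ P.extremePoints ℝ) {n : ℕ} (hn : L x - L p ≤ n) :
    ∃ x' ∈ P.extremePoints ℝ, L x' = L p ∧ Reach P n x x' := by
  induction n generalizing x with
  | zero =>
    refine ⟨x, hx, le_antisymm ?_ (hmin x hx.1), .refl 0 hx⟩
    push_cast at hn; linarith
  | succ n ih =>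
    rcases (hmin x hx.1).eq_or_lt with h | h
    · exact ⟨x, hx, h.symm, .refl _ hx⟩
    obtain ⟨w, hw, hlt⟩ := hP.exists_isEdge_lt hx hp.1 h
    obtain ⟨z, hz⟩ := hL x hx w hw.right_mem
    have hz1 : (1 : ℝ) ≤ z := by
      have : (0 : ℝ) < z := by linarith
      exact_mod_cast this
    push_cast at hn
    obtain ⟨x', hx', hx'p, hr⟩ := ih hw.right_mem (by linarith)
    exact ⟨x', hx', hx'p, .step hw hr⟩

end Polytopes

/-! ### Lattice polytopes in a cube and the heights above its facets -/

section Box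

variable {d : ℕ}

/-- A polytope with vertices in `{0, …, k}^d` on which the coordinates in `J` determine all the
others. Its dimension is at most `J.card`; faces cut out by a coordinate lose one element of `J`,
so that an induction on the dimension can stay in the same ambient space. -/
structure IsBoxPolytope (k : ℕ) (J : Finset (Fin d)) (P : Set (Fin d → ℝ)) : Prop where
  isCompact : IsCompact P
  convex : Convex ℝ P
  lattice : ∀ v ∈ P.extremePoints ℝ, ∀ i, ∃ n : ℕ, n ≤ k ∧ v i = n
  eq_of_eqOn : ∀ x ∈ P, ∀ y ∈ P, (∀ i ∈ J, x i = y i) → x = y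

variable {k : ℕ} {J : Finset (Fin d)} {P : Set (Fin d → ℝ)}

theorem IsBoxPolytope.isPolytope (hP : IsBoxPolytope k J P) : IsPolytope P where
  isCompact := hP.isCompact
  convex := hP.convex
  finite := by
    have hfin : (Set.range fun (z : Fin d → Fin (k + 1)) (i : Fin d) => ((z i : ℕ) : ℝ)).Finite :=
      Set.finite_range _
    refine hfin.subset fun v hv => ?_
    choose z hz hvz using hP.lattice v hv
    exact ⟨fun i => ⟨z i, Nat.lt_succ_of_le (hz i)⟩, funext fun i => (hvz i).symm⟩

theorem IsBoxPolytope.levelFace (hP : IsBoxPolytope k J P) {L : (Fin d → ℝ) →L[ℝ] ℝ} {γ : ℝ}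
    (hmin : ∀ x ∈ P, γ ≤ L x) {i : Fin d}
    (hdet : ∀ x ∈ levelFace P L γ, ∀ y ∈ levelFace P L γ,
      (∀ j ∈ J.erase i, x j = y j) → x i = y i) :
    IsBoxPolytope k (J.erase i) (levelFace P L γ) where
  isCompact := (hP.isPolytope.levelFace hmin).isCompact
  convex := (hP.isPolytope.levelFace hmin).convex
  lattice v hv := hP.lattice v ((isExtreme_levelFace hmin).extremePoints_subset_extremePoints hv)
  eq_of_eqOn x hx y hy h := by
    refine hP.eq_of_eqOn x hx.1 y hy.1 fun j hj => ?_
    by_cases hji : j = i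
    · rw [hji]; exact hdet x hx y hy h
    · exact h j (Finset.mem_erase.2 ⟨hji, hj⟩)

/-- The linear functional takes values differing by integers on the vertices of `P`. -/
def IsIntegralOn (P : Set (Fin d → ℝ)) (L : (Fin d → ℝ) →L[ℝ] ℝ) : Prop :=
  ∀ x ∈ P.extremePoints ℝ, ∀ y ∈ P.extremePoints ℝ, ∃ z : ℤ, L x - L y = z

theorem IsIntegralOn.add {L L' : (Fin d → ℝ) →L[ℝ] ℝ} (h : IsIntegralOn P L)
    (h' : IsIntegralOn P L') : IsIntegralOn P (L + L') := by
  intro x hx y hy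
  obtain ⟨z, hz⟩ := h x hx y hy
  obtain ⟨z', hz'⟩ := h' x hx y hy
  refine ⟨z + z', ?_⟩
  push_cast
  rw [← hz, ← hz']
  change L x + L' x - (L y + L' y) = _
  ring

/-- The facet `x_i = 0` (for `(i, false)`) or `x_i = k` (for `(i, true)`) of the cube
`[0, k]^d`. -/
abbrev Side (d : ℕ) := Fin d × Bool

/-- The facet parallel to a given one. -/
def Side.opp (a : Side d) : Side d := (a.1, !a.2)

@[simp] theorem Side.opp_fst (a : Side d) : a.opp.1 = a.1 := rfl

theorem Side.eq_or_eq_opp {a b : Side d} (h : a.1 = b.1) : b = a ∨ b = a.opp := by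
  obtain ⟨i, s⟩ := a
  obtain ⟨j, t⟩ := b
  obtain rfl : i = j := h
  cases s <;> cases t <;> simp [Side.opp]

/-- The linear part of the height above a facet of the cube. -/
noncomputable def sideForm (a : Side d) : (Fin d → ℝ) →L[ℝ] ℝ :=
  if a.2 then -(ContinuousLinearMap.proj a.1) else ContinuousLinearMap.proj a.1

/-- The distance of `x` from the facet `a` of the cube `[0, k]^d`. -/
noncomputable def height (k : ℕ) (a : Side d) (x : Fin d → ℝ) : ℝ :=
  if a.2 then k - x a.1 else x a.1

theorem height_opp (a : Side d) (x : Fin d → ℝ) : height k a.opp x = k - height k a x := by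
  obtain ⟨i, s⟩ := a
  cases s <;> simp [height, Side.opp]

theorem sideForm_eq (k : ℕ) (a : Side d) (x : Fin d → ℝ) :
    sideForm a x = height k a x - if a.2 then (k : ℝ) else 0 := by
  obtain ⟨i, s⟩ := a
  cases s <;> simp [height, sideForm]

theorem height_eq_iff {a : Side d} {x y : Fin d → ℝ} :
    height k a x = height k a y ↔ x a.1 = y a.1 := by
  obtain ⟨i, s⟩ := a
  cases s <;> simp [height]

theorem height_combo (a : Side d) (x y : Fin d → ℝ) {s t : ℝ} (h : s + t = 1) :
    height k a (s • x + t • y) = s * height k a x + t * height k a y := by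
  obtain ⟨i, e⟩ := a
  cases e
  · simp [height]
  · simp only [height, if_true, Pi.add_apply, Pi.smul_apply, smul_eq_mul]
    linear_combination -(k : ℝ) * h

theorem sub_eq_height_sub_or (a : Side d) (x y : Fin d → ℝ) :
    x a.1 - y a.1 = height k a x - height k a y ∨ x a.1 - y a.1 = height k a y - height k a x := by
  obtain ⟨i, s⟩ := a
  cases s <;> simp [height]

namespace IsBoxPolytope

theorem exists_height_eq (hP : IsBoxPolytope k J P) (a : Side d) {x : Fin d → ℝ}
    (hx : x ∈ P.extremePoints ℝ) : ∃ n : ℕ, n ≤ k ∧ height k a x = n := by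
  obtain ⟨n, hn, h⟩ := hP.lattice x hx a.1
  obtain ⟨i, s⟩ := a
  cases s
  · exact ⟨n, hn, by simpa [height] using h⟩
  · refine ⟨k - n, Nat.sub_le _ _, ?_⟩
    rw [Nat.cast_sub hn]
    simpa [height] using h

theorem isIntegralOn_sideForm (hP : IsBoxPolytope k J P) (a : Side d) :
    IsIntegralOn P (sideForm a) := by
  intro x hx y hy
  obtain ⟨m, -, hm⟩ := hP.exists_height_eq a hx
  obtain ⟨n, -, hn⟩ := hP.exists_height_eq a hy
  refine ⟨m - n, ?_⟩
  rw [sideForm_eq k, sideForm_eq k, hm, hn]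
  push_cast; ring

theorem height_nonneg (hP : IsBoxPolytope k J P) (a : Side d) {x : Fin d → ℝ} (hx : x ∈ P) :
    0 ≤ height k a x := by
  have h := hP.isPolytope.le_of_extremePoints (L := sideForm a)
    (γ := -if a.2 then (k : ℝ) else 0) (fun y hy => by
      obtain ⟨m, -, hm⟩ := hP.exists_height_eq a hy
      rw [sideForm_eq k, hm]
      have : (0 : ℝ) ≤ m := m.cast_nonneg
      linarith) x hx
  rw [sideForm_eq k] at h
  linarith

theorem height_le (hP : IsBoxPolytope k J P) (a : Side d) {x : Fin d → ℝ} (hx : x ∈ P) :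
    height k a x ≤ k := by
  have := hP.height_nonneg a.opp hx
  rw [height_opp] at this
  linarith

end IsBoxPolytope

/-- Two vertices are joined by descending from both to the face where `L` is least, and then
moving inside that face. -/
theorem IsPolytope.reach_via_levelFace (hP : IsPolytope P) {L : (Fin d → ℝ) →L[ℝ] ℝ}
    (hL : IsIntegralOn P L) {p : Fin d → ℝ} (hp : p ∈ P.extremePoints ℝ)
    (hmin : ∀ q ∈ P, L p ≤ L q) {N : ℕ}
    (hN : ∀ x ∈ (_root_.levelFace P L (L p)).extremePoints ℝ,
      ∀ y ∈ (_root_.levelFace P L (L p)).extremePoints ℝ,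
        Reach (_root_.levelFace P L (L p)) N x y)
    {x y : Fin d → ℝ} (hx : x ∈ P.extremePoints ℝ) (hy : y ∈ P.extremePoints ℝ) {n : ℕ}
    (hn : L x + L y - 2 * L p ≤ n) : Reach P (n + N) x y := by
  have hnat : ∀ z ∈ P.extremePoints ℝ, ∃ m : ℕ, L z - L p = m := by
    intro z hz
    obtain ⟨t, ht⟩ := hL z hz p hp
    have h0 : (0 : ℝ) ≤ t := by rw [← ht]; linarith [hmin z hz.1]
    obtain ⟨m, rfl⟩ := Int.eq_ofNat_of_zero_le (by exact_mod_cast h0 : 0 ≤ t)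
    exact ⟨m, by exact_mod_cast ht⟩
  obtain ⟨m1, h1⟩ := hnat x hx
  obtain ⟨m2, h2⟩ := hnat y hy
  obtain ⟨x', hx', hx'p, hrx⟩ := hP.exists_reach_min hL hp hmin hx h1.le
  obtain ⟨y', hy', hy'p, hry⟩ := hP.exists_reach_min hL hp hmin hy h2.le
  have hF := isExtreme_levelFace hmin
  have hr := hN x' (by rw [hF.extremePoints_eq]; exact ⟨⟨hx'.1, hx'p⟩, hx'⟩)
    y' (by rw [hF.extremePoints_eq]; exact ⟨⟨hy'.1, hy'p⟩, hy'⟩)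
  refine ((hrx.trans (hr.of_isExtreme hF)).trans hry.symm).mono ?_
  have : ((m1 + m2 : ℕ) : ℝ) ≤ n := by push_cast; linarith
  have : m1 + m2 ≤ n := by exact_mod_cast this
  omega

theorem IsPolytope.exists_min (hP : IsPolytope P) (hne : (P.extremePoints ℝ).Nonempty)
    (L : (Fin d → ℝ) →L[ℝ] ℝ) : ∃ p ∈ P.extremePoints ℝ, ∀ q ∈ P, L p ≤ L q := by
  obtain ⟨p, hp, h⟩ := hP.finite.exists_minimalFor L _ hne
  refine ⟨p, hp, hP.le_of_extremePoints fun q hq => ?_⟩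
  by_contra hcon
  push Not at hcon
  exact absurd (h hq hcon.le) (not_le.2 hcon)

/-- If the coordinate `i` varies by at most `r` on `P`, then one of the two faces where it is
extremal is reached from both of two given vertices within `r` steps altogether. -/
theorem IsBoxPolytope.reach_of_range (hP : IsBoxPolytope k J P) (i : Fin d) {r N : ℕ}
    (hr : ∀ p ∈ P, ∀ q ∈ P, p i - q i ≤ r)
    (hN : ∀ Q ⊆ P, IsBoxPolytope k (J.erase i) Q →
      ∀ x ∈ Q.extremePoints ℝ, ∀ y ∈ Q.extremePoints ℝ, Reach Q N x y)
    {x y : Fin d → ℝ} (hx : x ∈ P.extremePoints ℝ) (hy : y ∈ P.extremePoints ℝ) :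
    Reach P (r + N) x y := by
  have key : ∀ s : Bool, ∃ p ∈ P, (height k (i, s) x + height k (i, s) y -
      2 * height k (i, s) p ≤ r → Reach P (r + N) x y) := by
    intro s
    obtain ⟨p, hp, hmin⟩ := hP.isPolytope.exists_min ⟨x, hx⟩ (sideForm (i, s))
    refine ⟨p, hp.1, fun h => ?_⟩
    refine hP.isPolytope.reach_via_levelFace (hP.isIntegralOn_sideForm (i, s)) hp hmin
      (fun x' hx' y' hy' => hN _ (fun z hz => hz.1) (hP.levelFace hmin ?_) x' hx' y' hy') hx hy ?_
    · intro z hz w hw _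
      have := hz.2.trans hw.2.symm
      rw [sideForm_eq k, sideForm_eq k] at this
      exact height_eq_iff.1 (sub_left_injective this)
    · rw [sideForm_eq k, sideForm_eq k, sideForm_eq k]
      linarith
  obtain ⟨p, hp, h0⟩ := key false
  obtain ⟨q, hq, h1⟩ := key true
  have hpq := hr q hq p hp
  simp only [height, Bool.false_eq_true, if_false, if_true] at h0 h1
  by_cases h : x i + y i - 2 * p i ≤ r
  · exact h0 h
  · exact h1 (by push Not at h; linarith)

/-- The bound `k n - ⌈2 n / 3⌉` on the diameter in dimension `n`. -/
def diamBound (k n : ℕ) : ℕ := k * n - (2 * n + 2) / 3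

theorem diamBound_add (hk : 3 ≤ k) (n : ℕ) : diamBound k n + (2 * n + 2) / 3 = k * n := by
  have : 3 * n ≤ k * n := Nat.mul_le_mul_right n hk
  unfold diamBound
  omega

theorem diamBound_succ (hk : 3 ≤ k) (n : ℕ) : diamBound k n + k ≤ diamBound k (n + 1) + 1 := by
  have h1 := diamBound_add hk n
  have h2 := diamBound_add hk (n + 1)
  rw [mul_add k n 1] at h2
  omega

theorem diamBound_add_two (hk : 3 ≤ k) (n : ℕ) :
    diamBound k n + 2 * k ≤ diamBound k (n + 2) + 2 := by
  have h1 := diamBound_add hk n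
  have h2 := diamBound_add hk (n + 2)
  rw [mul_add k n 2] at h2
  omega

theorem diamBound_add_three (hk : 3 ≤ k) (n : ℕ) :
    diamBound k n + 3 * k ≤ diamBound k (n + 3) + 2 := by
  have h1 := diamBound_add hk n
  have h2 := diamBound_add hk (n + 3)
  rw [mul_add k n 3] at h2
  omega

end Box

/-! ### Pairs of vertices at too large a distance -/

section BadPair

variable {d : ℕ}

/-- A minimal counterexample: two vertices `u` and `v` of `P` that violate the bound, while the
bound holds in smaller dimensions. -/
structure IsBadPair (k : ℕ) (J : Finset (Fin d)) (P : Set (Fin d → ℝ)) (u v : Fin d → ℝ) :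
    Prop where
  three_le : 3 ≤ k
  box : IsBoxPolytope k J P
  left_mem : u ∈ P.extremePoints ℝ
  right_mem : v ∈ P.extremePoints ℝ
  bound_of_lt : ∀ (J' : Finset (Fin d)) (Q : Set (Fin d → ℝ)), J'.card < J.card →
    IsBoxPolytope k J' Q → ∀ x ∈ Q.extremePoints ℝ, ∀ y ∈ Q.extremePoints ℝ,
      Reach Q (diamBound k J'.card) x y
  not_reach : ¬ Reach P (diamBound k J.card) u v

variable {k : ℕ} {J : Finset (Fin d)} {P : Set (Fin d → ℝ)} {u v : Fin d → ℝ}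

namespace IsBadPair

theorem symm (h : IsBadPair k J P u v) : IsBadPair k J P v u :=
  ⟨h.three_le, h.box, h.right_mem, h.left_mem, h.bound_of_lt, fun h' => h.not_reach h'.symm⟩

theorem three_le_cast (h : IsBadPair k J P u v) : (3 : ℝ) ≤ k := by exact_mod_cast h.three_le

/-- The walks `u → w₁` and `v → w₂`, continued to the face where `L` is least, cannot be short. -/
theorem lt_of_levelFace (h : IsBadPair k J P u v) {L : (Fin d → ℝ) →L[ℝ] ℝ}
    (hL : IsIntegralOn P L) {p : Fin d → ℝ} (hp : p ∈ P.extremePoints ℝ)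
    (hmin : ∀ q ∈ P, L p ≤ L q) {N : ℕ}
    (hN : ∀ x ∈ (levelFace P L (L p)).extremePoints ℝ,
      ∀ y ∈ (levelFace P L (L p)).extremePoints ℝ, Reach (levelFace P L (L p)) N x y)
    {m₁ m₂ : ℕ} {w₁ w₂ : Fin d → ℝ} (h₁ : Reach P m₁ u w₁) (h₂ : Reach P m₂ v w₂) :
    (diamBound k J.card + 1 : ℝ) ≤ m₁ + m₂ + (L w₁ + L w₂ - 2 * L p) + N := by
  obtain ⟨t₁, ht₁⟩ := hL w₁ h₁.right_mem p hp
  obtain ⟨t₂, ht₂⟩ := hL w₂ h₂.right_mem p hp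
  have hnn : (0 : ℝ) ≤ ((t₁ + t₂ : ℤ) : ℝ) := by
    push_cast
    rw [← ht₁, ← ht₂]
    linarith [hmin w₁ h₁.right_mem.1, hmin w₂ h₂.right_mem.1]
  obtain ⟨n, hn⟩ := Int.eq_ofNat_of_zero_le (by exact_mod_cast hnn : 0 ≤ t₁ + t₂)
  have hn' : L w₁ + L w₂ - 2 * L p = n := by
    have : ((t₁ + t₂ : ℤ) : ℝ) = n := by rw [hn]; simp
    push_cast at this
    linarith
  have hr := (h₁.trans (h.box.isPolytope.reach_via_levelFace hL hp hmin hN h₁.right_mem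
    h₂.right_mem hn'.le)).trans h₂.symm
  rw [hn']
  by_contra hcon
  push Not at hcon
  have hlt : m₁ + m₂ + n + N < diamBound k J.card + 1 := by exact_mod_cast hcon
  exact h.not_reach (hr.mono (by omega))

theorem exists_min_height (h : IsBadPair k J P u v) {a : Side d} (ha : a.1 ∈ J) :
    ∃ p ∈ P.extremePoints ℝ, ∀ (m₁ m₂ : ℕ) (w₁ w₂ : Fin d → ℝ), Reach P m₁ u w₁ →
      Reach P m₂ v w₂ → (k : ℝ) ≤ m₁ + m₂ + (height k a w₁ + height k a w₂) - 2 * height k a p := by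
  obtain ⟨p, hp, hmin⟩ := h.box.isPolytope.exists_min ⟨u, h.left_mem⟩ (sideForm a)
  refine ⟨p, hp, fun m₁ m₂ w₁ w₂ h₁ h₂ => ?_⟩
  have hcard : J.card = (J.erase a.1).card + 1 := (Finset.card_erase_add_one ha).symm
  have hlt := h.lt_of_levelFace (h.box.isIntegralOn_sideForm a) hp hmin
    (N := diamBound k (J.erase a.1).card) (h.bound_of_lt _ _ (by omega)
      (h.box.levelFace hmin fun x hx y hy _ => by
        have := hx.2.trans hy.2.symm
        rw [sideForm_eq k, sideForm_eq k] at this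
        exact height_eq_iff.1 (sub_left_injective this))) h₁ h₂
  rw [sideForm_eq k, sideForm_eq k, sideForm_eq k, hcard] at hlt
  have hb : (diamBound k (J.erase a.1).card + k : ℝ) ≤
      diamBound k ((J.erase a.1).card + 1) + 1 := by
    exact_mod_cast diamBound_succ h.three_le _
  linarith

/-- In the directions of `J`, the vertices of a bad pair are opposite, and `P` meets all the facets
of the cube. -/
theorem height_add_and_exists (h : IsBadPair k J P u v) {a : Side d} (ha : a.1 ∈ J) :
    height k a u + height k a v = k ∧ ∃ p ∈ P.extremePoints ℝ, height k a p = 0 := by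
  obtain ⟨p, hp, h1⟩ := h.exists_min_height ha
  obtain ⟨q, hq, h2⟩ := h.exists_min_height (a := a.opp) ha
  have e1 := h1 0 0 u v (.refl 0 h.left_mem) (.refl 0 h.right_mem)
  have e2 := h2 0 0 u v (.refl 0 h.left_mem) (.refl 0 h.right_mem)
  rw [height_opp, height_opp] at e2
  have hp0 := h.box.height_nonneg a hp.1
  have hq0 := h.box.height_nonneg a.opp hq.1
  push_cast at e1 e2
  exact ⟨by linarith, p, hp, by linarith⟩

theorem height_add (h : IsBadPair k J P u v) {a : Side d} (ha : a.1 ∈ J) :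
    height k a u + height k a v = k := (h.height_add_and_exists ha).1

/-- No walk from `u` or `v` moves towards a facet faster than one unit per step. -/
theorem le_one_side (h : IsBadPair k J P u v) {a : Side d} (ha : a.1 ∈ J)
    {m₁ m₂ : ℕ} {w₁ w₂ : Fin d → ℝ} (h₁ : Reach P m₁ u w₁) (h₂ : Reach P m₂ v w₂) :
    height k a u + height k a v ≤ m₁ + m₂ + (height k a w₁ + height k a w₂) := by
  obtain ⟨p, hp, h1⟩ := h.exists_min_height ha
  have e := h1 m₁ m₂ w₁ w₂ h₁ h₂
  have hp0 := h.box.height_nonneg a hp.1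
  rw [h.height_add ha]
  linarith

/-- Two walks moving towards two facets simultaneously save at most one step altogether, and none
at all if the two facets have no common point in `P`. -/
theorem exists_le_two_sides (h : IsBadPair k J P u v) {a b : Side d} (ha : a.1 ∈ J) (hb : b.1 ∈ J)
    (hab : a.1 ≠ b.1) : ∃ p ∈ P.extremePoints ℝ,
      (∀ q ∈ P, height k a p + height k b p ≤ height k a q + height k b q) ∧
      ∀ (m₁ m₂ : ℕ) (w₁ w₂ : Fin d → ℝ), Reach P m₁ u w₁ → Reach P m₂ v w₂ →
        height k a u + height k b u + (height k a v + height k b v) +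
          (height k a p + height k b p) ≤
        m₁ + m₂ + (height k a w₁ + height k b w₁) + (height k a w₂ + height k b w₂) + 1 := by
  obtain ⟨p, hp, hmin⟩ := h.box.isPolytope.exists_min ⟨u, h.left_mem⟩ (sideForm a + sideForm b)
  have hval : ∀ x, (sideForm a + sideForm b) x = height k a x + height k b x -
      ((if a.2 then (k : ℝ) else 0) + if b.2 then (k : ℝ) else 0) := fun x => by
    change sideForm a x + sideForm b x = _
    rw [sideForm_eq k, sideForm_eq k]; ring
  refine ⟨p, hp, fun q hq => ?_, fun m₁ m₂ w₁ w₂ h₁ h₂ => ?_⟩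
  · have := hmin q hq
    rw [hval, hval] at this
    linarith
  have hFval : ∀ x ∈ levelFace P (sideForm a + sideForm b) ((sideForm a + sideForm b) p),
      height k a x + height k b x = height k a p + height k b p := fun x hx => by
    have := hx.2
    rw [hval, hval] at this
    linarith
  have hb' : b.1 ∈ J.erase a.1 := Finset.mem_erase.2 ⟨hab.symm, hb⟩
  have hF : IsBoxPolytope k (J.erase a.1)
      (levelFace P (sideForm a + sideForm b) ((sideForm a + sideForm b) p)) :=
    h.box.levelFace hmin fun x hx y hy hxy => by
      have e1 := (hFval x hx).trans (hFval y hy).symm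
      have e2 : height k b x = height k b y := height_eq_iff.2 (hxy b.1 hb')
      exact height_eq_iff.1 (by linarith : height k a x = height k a y)
  have hcard : J.card = ((J.erase a.1).erase b.1).card + 2 := by
    rw [← Finset.card_erase_add_one ha, ← Finset.card_erase_add_one hb']
  obtain ⟨g₁, -, hg₁⟩ := h.box.exists_height_eq a hp
  obtain ⟨g₂, -, hg₂⟩ := h.box.exists_height_eq b hp
  have hrange : ∀ x ∈ levelFace P (sideForm a + sideForm b) ((sideForm a + sideForm b) p),
      ∀ y ∈ levelFace P (sideForm a + sideForm b) ((sideForm a + sideForm b) p),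
        x b.1 - y b.1 ≤ (g₁ + g₂ : ℕ) := by
    intro x hx y hy
    have hx1 := h.box.height_nonneg a hx.1
    have hx2 := h.box.height_nonneg b hx.1
    have hy1 := h.box.height_nonneg a hy.1
    have hy2 := h.box.height_nonneg b hy.1
    have ex := hFval x hx
    have ey := hFval y hy
    have hxy := sub_eq_height_sub_or (k := k) b x y
    rw [hg₁, hg₂] at ex ey
    push_cast
    rcases hxy with hxy | hxy <;> linarith
  have hlt := h.lt_of_levelFace ((h.box.isIntegralOn_sideForm a).add
    (h.box.isIntegralOn_sideForm b)) hp hmin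
    (fun x hx y hy => hF.reach_of_range b.1 hrange
      (fun Q _ hQ => h.bound_of_lt _ Q (by omega) hQ) hx hy) h₁ h₂
  rw [hval, hval, hval, hcard] at hlt
  have hbd : (diamBound k ((J.erase a.1).erase b.1).card + 2 * k : ℝ) ≤
      diamBound k (((J.erase a.1).erase b.1).card + 2) + 2 := by
    exact_mod_cast diamBound_add_two h.three_le _
  have ka := h.height_add ha
  have kb := h.height_add hb
  push_cast at hlt
  linarith

/-- Two walks moving towards three facets simultaneously save at most one step altogether. -/
theorem le_three_sides (h : IsBadPair k J P u v) {a b c : Side d} (ha : a.1 ∈ J) (hb : b.1 ∈ J)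
    (hc : c.1 ∈ J) (hab : a.1 ≠ b.1) (hac : a.1 ≠ c.1) (hbc : b.1 ≠ c.1)
    {m₁ m₂ : ℕ} {w₁ w₂ : Fin d → ℝ} (h₁ : Reach P m₁ u w₁) (h₂ : Reach P m₂ v w₂) :
    height k a u + height k b u + height k c u + (height k a v + height k b v + height k c v) ≤
      m₁ + m₂ + (height k a w₁ + height k b w₁ + height k c w₁) +
        (height k a w₂ + height k b w₂ + height k c w₂) + 1 := by
  set L := sideForm a + sideForm b + sideForm c with hLdef
  obtain ⟨p, hp, hmin⟩ := h.box.isPolytope.exists_min ⟨u, h.left_mem⟩ L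
  have hval : ∀ x, L x = height k a x + height k b x + height k c x -
      ((if a.2 then (k : ℝ) else 0) + (if b.2 then (k : ℝ) else 0) +
        if c.2 then (k : ℝ) else 0) := fun x => by
    change sideForm a x + sideForm b x + sideForm c x = _
    rw [sideForm_eq k, sideForm_eq k, sideForm_eq k]; ring
  have hFval : ∀ x ∈ levelFace P L (L p), height k a x + height k b x + height k c x =
      height k a p + height k b p + height k c p := fun x hx => by
    have := hx.2
    rw [hval, hval] at this
    linarith
  have hb' : b.1 ∈ J.erase a.1 := Finset.mem_erase.2 ⟨hab.symm, hb⟩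
  have hc' : c.1 ∈ J.erase a.1 := Finset.mem_erase.2 ⟨hac.symm, hc⟩
  have hc'' : c.1 ∈ (J.erase a.1).erase b.1 := Finset.mem_erase.2 ⟨hbc.symm, hc'⟩
  have hF : IsBoxPolytope k (J.erase a.1) (levelFace P L (L p)) :=
    h.box.levelFace hmin fun x hx y hy hxy => by
      have e1 := (hFval x hx).trans (hFval y hy).symm
      have e2 : height k b x = height k b y := height_eq_iff.2 (hxy b.1 hb')
      have e3 : height k c x = height k c y := height_eq_iff.2 (hxy c.1 hc')
      exact height_eq_iff.1 (by linarith : height k a x = height k a y)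
  have hcard : J.card = (((J.erase a.1).erase b.1).erase c.1).card + 3 := by
    rw [← Finset.card_erase_add_one ha, ← Finset.card_erase_add_one hb',
      ← Finset.card_erase_add_one hc'']
  obtain ⟨g₁, -, hg₁⟩ := h.box.exists_height_eq a hp
  obtain ⟨g₂, -, hg₂⟩ := h.box.exists_height_eq b hp
  obtain ⟨g₃, -, hg₃⟩ := h.box.exists_height_eq c hp
  have hrange : ∀ e : Side d, (∀ x ∈ levelFace P L (L p), height k e x ≤ g₁ + g₂ + g₃) →
      ∀ x ∈ levelFace P L (L p), ∀ y ∈ levelFace P L (L p),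
        x e.1 - y e.1 ≤ (g₁ + g₂ + g₃ : ℕ) := by
    intro e he x hx y hy
    have hx1 := h.box.height_nonneg e hx.1
    have hy1 := h.box.height_nonneg e hy.1
    have ex := he x hx
    have ey := he y hy
    push_cast
    rcases sub_eq_height_sub_or (k := k) e x y with hxy | hxy <;> linarith
  have hrb := hrange b fun x hx => by
    have hx1 := h.box.height_nonneg a hx.1
    have hx2 := h.box.height_nonneg c hx.1
    have := hFval x hx
    linarith
  have hrc := hrange c fun x hx => by
    have hx1 := h.box.height_nonneg a hx.1
    have hx2 := h.box.height_nonneg b hx.1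
    have := hFval x hx
    linarith
  have hlt := h.lt_of_levelFace (((h.box.isIntegralOn_sideForm a).add
    (h.box.isIntegralOn_sideForm b)).add (h.box.isIntegralOn_sideForm c)) hp hmin
    (fun x hx y hy => hF.reach_of_range b.1 hrb
      (fun Q hQF hQ x' hx' y' hy' => hQ.reach_of_range c.1
        (fun z hz w hw => hrc z (hQF hz) w (hQF hw))
        (fun R _ hR => h.bound_of_lt _ R (by omega) hR) hx' hy') hx hy) h₁ h₂
  rw [hval, hval, hval, hcard] at hlt
  have hbd : (diamBound k (((J.erase a.1).erase b.1).erase c.1).card + 3 * k : ℝ) ≤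
      diamBound k ((((J.erase a.1).erase b.1).erase c.1).card + 3) + 2 := by
    exact_mod_cast diamBound_add_three h.three_le _
  have ka := h.height_add ha
  have kb := h.height_add hb
  have kc := h.height_add hc
  push_cast at hlt
  linarith

/-- A weaker form of `exists_le_two_sides`, of the same shape as `le_three_sides`. -/
theorem le_two_sides (h : IsBadPair k J P u v) {a b : Side d} (ha : a.1 ∈ J) (hb : b.1 ∈ J)
    (hab : a.1 ≠ b.1) {m₁ m₂ : ℕ} {w₁ w₂ : Fin d → ℝ} (h₁ : Reach P m₁ u w₁)
    (h₂ : Reach P m₂ v w₂) :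
    height k a u + height k b u + (height k a v + height k b v) ≤
      m₁ + m₂ + (height k a w₁ + height k b w₁) + (height k a w₂ + height k b w₂) + 1 := by
  obtain ⟨p, hp, -, hle⟩ := h.exists_le_two_sides ha hb hab
  have := hle m₁ m₂ w₁ w₂ h₁ h₂
  linarith [h.box.height_nonneg a hp.1, h.box.height_nonneg b hp.1]

end IsBadPair

end BadPair

/-! ### Walks that save a step -/

section Saving

variable {d : ℕ} {k : ℕ} {J : Finset (Fin d)} {P : Set (Fin d → ℝ)} {u v : Fin d → ℝ}

theorem coord_combo_of_height {a : Side d} {w x y : Fin d → ℝ} {s t : ℝ} (hst : s + t = 1)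
    (h : height k a w = s * height k a x + t * height k a y) :
    w a.1 = s * x a.1 + t * y a.1 := by
  rw [← height_combo a x y hst, height_eq_iff] at h
  simpa using h

namespace IsBoxPolytope

/-- A vertex is not a proper convex combination; it is enough to compare the coordinates
in `J`. -/
theorem eq_of_combo (hP : IsBoxPolytope k J P) {w x y : Fin d → ℝ} (hw : w ∈ P.extremePoints ℝ)
    (hx : x ∈ P) (hy : y ∈ P) {s t : ℝ} (hs : 0 < s) (ht : 0 < t) (hst : s + t = 1)
    (h : ∀ i ∈ J, w i = s * x i + t * y i) : x = w ∧ y = w := by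
  have hmem : s • x + t • y ∈ P := hP.convex hx hy hs.le ht.le hst
  have hwe : w = s • x + t • y :=
    hP.eq_of_eqOn w hw.1 _ hmem fun i hi => by simpa using h i hi
  exact (mem_extremePoints.1 hw).2 x hx y hy ⟨s, t, hs, ht, hst, hwe.symm⟩

theorem height_le_sub_one (hP : IsBoxPolytope k J P) {a : Side d} {x y : Fin d → ℝ}
    (hx : x ∈ P.extremePoints ℝ) (hy : y ∈ P.extremePoints ℝ) (h : height k a y < height k a x) :
    height k a y ≤ height k a x - 1 := by
  obtain ⟨m, -, hm⟩ := hP.exists_height_eq a hx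
  obtain ⟨n, -, hn⟩ := hP.exists_height_eq a hy
  rw [hm, hn] at h ⊢
  have : n + 1 ≤ m := by exact_mod_cast h
  have : (n + 1 : ℝ) ≤ m := by exact_mod_cast this
  linarith

theorem exists_height_le_sub_one (hP : IsBoxPolytope k J P) {i : Fin d} {x y : Fin d → ℝ}
    (hx : x ∈ P.extremePoints ℝ) (hy : y ∈ P.extremePoints ℝ) (h : y i ≠ x i) :
    ∃ b : Side d, b.1 = i ∧ height k b y ≤ height k b x - 1 := by
  rcases lt_or_gt_of_ne h with h | h
  · exact ⟨(i, false), rfl, hP.height_le_sub_one hx hy (by simpa [height] using h)⟩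
  · exact ⟨(i, true), rfl, hP.height_le_sub_one hx hy (by simpa [height] using h)⟩

end IsBoxPolytope

/-- Some walk of length `m` from `x` gets `m` closer to the facet `a`, and on the way also closer
to the facet `b`. -/
def Saves (k : ℕ) (P : Set (Fin d → ℝ)) (x : Fin d → ℝ) (a b : Side d) : Prop :=
  ∃ (m : ℕ) (w : Fin d → ℝ), Reach P m x w ∧ height k a w = height k a x - m ∧
    height k b w ≤ height k b x - 1

/-- Some walk of length `m` from `x` decreases the sum of the distances to the facets `a` and `b`
by more than `m`. -/
def SavesPair (k : ℕ) (P : Set (Fin d → ℝ)) (x : Fin d → ℝ) (a b : Side d) : Prop :=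
  ∃ (m : ℕ) (w : Fin d → ℝ), Reach P m x w ∧
    height k a w + height k b w ≤ height k a x + height k b x - m - 1

theorem Saves.savesPair {x : Fin d → ℝ} {a b : Side d} (h : Saves k P x a b) :
    SavesPair k P x a b := by
  obtain ⟨m, w, hr, h1, h2⟩ := h
  exact ⟨m, w, hr, by linarith⟩

theorem SavesPair.swap {x : Fin d → ℝ} {a b : Side d} (h : SavesPair k P x a b) :
    SavesPair k P x b a := by
  obtain ⟨m, w, hr, h1⟩ := h
  exact ⟨m, w, hr, by linarith⟩

namespace IsBadPair

/-- A walk that saves a step towards `a` and `b` fixes every other coordinate: it would save a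
second step towards one of the two facets in that direction. -/
theorem eq_of_savesPair (h : IsBadPair k J P u v) {a b : Side d} (ha : a.1 ∈ J) (hb : b.1 ∈ J)
    (hab : a.1 ≠ b.1) {m : ℕ} {w : Fin d → ℝ} (hw : Reach P m u w)
    (hs : height k a w + height k b w ≤ height k a u + height k b u - m - 1)
    {l : Fin d} (hl : l ∈ J) (hla : a.1 ≠ l) (hlb : b.1 ≠ l) : w l = u l := by
  have e1 := h.le_three_sides ha hb (c := (l, false)) hl hab hla hlb hw (.refl 0 h.right_mem)
  have e2 := h.le_three_sides ha hb (c := (l, true)) hl hab hla hlb hw (.refl 0 h.right_mem)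
  simp only [height, Bool.false_eq_true, if_false, if_true] at e1 e2 hs
  push_cast at e1 e2
  linarith

/-- If both vertices save steps towards the same facet `a`, then the other directions involved must
be opposite. -/
theorem eq_opp_of_savesPair (h : IsBadPair k J P u v) {a b c : Side d} (ha : a.1 ∈ J)
    (hb : b.1 ∈ J) (hc : c.1 ∈ J) (hab : a.1 ≠ b.1) (hac : a.1 ≠ c.1)
    (hu : SavesPair k P u a b) (hv : SavesPair k P v a c) : c = b.opp := by
  obtain ⟨m₁, w₁, hr₁, h₁⟩ := hu
  obtain ⟨m₂, w₂, hr₂, h₂⟩ := hv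
  by_cases hbc : b.1 = c.1
  · rcases Side.eq_or_eq_opp hbc with rfl | hc'
    · have := h.le_two_sides ha hb hab hr₁ hr₂
      linarith
    · exact hc'
  · have e1 := h.eq_of_savesPair ha hb hab hr₁ h₁ hc hac hbc
    have e2 := h.symm.eq_of_savesPair ha hc hac hr₂ h₂ hb hab (Ne.symm hbc)
    have e3 := h.le_three_sides ha hb hc hab hac hbc hr₁ hr₂
    rw [← height_eq_iff (k := k)] at e1 e2
    linarith

/-- A walk that approaches `a` as fast as possible can be continued by one step. -/
theorem exists_isEdge_height (h : IsBadPair k J P u v) {a : Side d} (ha : a.1 ∈ J) {m : ℕ}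
    {x : Fin d → ℝ} (hx : Reach P m u x) (hax : height k a x = height k a u - m)
    (hpos : 0 < height k a x) : ∃ w, IsEdge P x w ∧ height k a w = height k a x - 1 := by
  obtain ⟨-, p, hp, hp0⟩ := h.height_add_and_exists ha
  obtain ⟨w, hw, hlt⟩ := h.box.isPolytope.exists_isEdge_lt hx.right_mem (c := sideForm a) hp.1 (by
    rw [sideForm_eq k, sideForm_eq k]; linarith)
  rw [sideForm_eq k, sideForm_eq k] at hlt
  refine ⟨w, hw, le_antisymm (h.box.height_le_sub_one hw.left_mem hw.right_mem (by linarith)) ?_⟩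
  have := h.le_one_side ha (hx.trans (.of_isEdge hw)) (.refl 0 h.right_mem)
  push_cast at this
  linarith

theorem exists_reach_side (h : IsBadPair k J P u v) {a : Side d} (ha : a.1 ∈ J)
    {x : Fin d → ℝ} (hx : x ∈ P.extremePoints ℝ) :
    ∃ x', height k a x' = 0 ∧ ∃ n : ℕ, height k a x = n ∧ Reach P n x x' := by
  obtain ⟨-, p, hp, hp0⟩ := h.height_add_and_exists ha
  obtain ⟨n, -, hn⟩ := h.box.exists_height_eq a hx
  obtain ⟨x', -, hx'p, hr⟩ := h.box.isPolytope.exists_reach_min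
    (h.box.isIntegralOn_sideForm a) hp (fun q hq => by
      rw [sideForm_eq k, sideForm_eq k]
      linarith [h.box.height_nonneg a hq]) hx (n := n) (by
      rw [sideForm_eq k, sideForm_eq k]; linarith)
  rw [sideForm_eq k, sideForm_eq k] at hx'p
  exact ⟨x', by linarith, n, hn, hr⟩

/-- When one of the two vertices saves a step towards `a` and `b`, these two facets meet in `P`,
and their intersection is reached from any vertex by descending on both coordinates. -/
theorem exists_reach_corner (h : IsBadPair k J P u v) {a b : Side d} (ha : a.1 ∈ J) (hb : b.1 ∈ J)
    (hab : a.1 ≠ b.1) (hu : SavesPair k P u a b) {x : Fin d → ℝ} (hx : x ∈ P.extremePoints ℝ) :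
    ∃ x', height k a x' = 0 ∧ height k b x' = 0 ∧
      ∃ n : ℕ, height k a x + height k b x = n ∧ Reach P n x x' := by
  obtain ⟨m, w, hr, hs⟩ := hu
  obtain ⟨p, hp, hmin, hle⟩ := h.exists_le_two_sides ha hb hab
  have e := hle m 0 w v hr (.refl 0 h.right_mem)
  have pa := h.box.height_nonneg a hp.1
  have pb := h.box.height_nonneg b hp.1
  push_cast at e
  obtain ⟨n₁, -, hn₁⟩ := h.box.exists_height_eq a hx
  obtain ⟨n₂, -, hn₂⟩ := h.box.exists_height_eq b hx
  have hval : ∀ x, (sideForm a + sideForm b) x = height k a x + height k b x -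
      ((if a.2 then (k : ℝ) else 0) + if b.2 then (k : ℝ) else 0) := fun x => by
    change sideForm a x + sideForm b x = _
    rw [sideForm_eq k, sideForm_eq k]; ring
  obtain ⟨x', hx', hx'p, hreach⟩ := h.box.isPolytope.exists_reach_min
    ((h.box.isIntegralOn_sideForm a).add (h.box.isIntegralOn_sideForm b)) hp (fun q hq => by
      rw [hval, hval]; linarith [hmin q hq]) hx (n := n₁ + n₂) (by
      rw [hval, hval]; push_cast; linarith)
  rw [hval, hval] at hx'p
  have xa := h.box.height_nonneg a hx'.1
  have xb := h.box.height_nonneg b hx'.1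
  exact ⟨x', by linarith, by linarith, n₁ + n₂, by push_cast; linarith, hreach⟩

/-- An edge towards `a` changes only the coordinate of `a`, unless it saves a step. -/
theorem saves_or_eq (h : IsBadPair k J P u v) {a : Side d} {w : Fin d → ℝ}
    (hw : IsEdge P u w) (haw : height k a w = height k a u - 1) :
    (∃ b : Side d, b.1 ∈ J ∧ a.1 ≠ b.1 ∧ Saves k P u a b) ∨
      ∀ j ∈ J, a.1 ≠ j → w j = u j := by
  by_cases hpure : ∀ j ∈ J, a.1 ≠ j → w j = u j
  · exact .inr hpure
  push Not at hpure
  obtain ⟨j, hj, haj, hne⟩ := hpure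
  obtain ⟨b, rfl, hb⟩ := h.box.exists_height_le_sub_one hw.left_mem hw.right_mem hne
  exact .inl ⟨b, hj, haj, 1, w, .of_isEdge hw, by push_cast; exact haw, hb⟩

/-- From height at least two above `a`, two consecutive steps towards `a` cannot be collinear, so
one of them also approaches another facet. -/
theorem exists_saves (h : IsBadPair k J P u v) {a : Side d} (ha : a.1 ∈ J)
    (h2 : 2 ≤ height k a u) : ∃ b : Side d, b.1 ∈ J ∧ a.1 ≠ b.1 ∧ Saves k P u a b := by
  obtain ⟨w, hw, haw⟩ := h.exists_isEdge_height ha (.refl 0 h.left_mem) (by simp) (by linarith)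
  rcases h.saves_or_eq hw haw with hs | hpure
  · exact hs
  obtain ⟨w', hw', haw'⟩ := h.exists_isEdge_height ha (.of_isEdge hw) (by push_cast; exact haw)
    (by linarith)
  by_cases hpure' : ∀ j ∈ J, a.1 ≠ j → w' j = w j
  · have := (h.box.eq_of_combo hw.right_mem h.left_mem.1 hw'.right_mem.1 (s := 1 / 2) (t := 1 / 2)
      (by norm_num) (by norm_num) (by norm_num) fun i hi => by
        by_cases hia : a.1 = i
        · subst hia
          exact coord_combo_of_height (k := k) (by norm_num) (by linarith)
        · rw [hpure' i hi hia, hpure i hi hia]; ring).1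
    rw [← this] at haw
    linarith
  · push Not at hpure'
    obtain ⟨j, hj, haj, hne⟩ := hpure'
    obtain ⟨b, rfl, hb⟩ := h.box.exists_height_le_sub_one hw'.left_mem hw'.right_mem hne
    refine ⟨b, hj, haj, 2, w', (Reach.of_isEdge hw).trans (.of_isEdge hw'), ?_, ?_⟩
    · push_cast; linarith
    · rw [← height_eq_iff.2 (hpure b.1 hj haj)]; exact hb

end IsBadPair

end Saving

/-! ### Two vertices cannot save steps towards the same facet -/

section Conflict

variable {d : ℕ} {k : ℕ} {J : Finset (Fin d)} {P : Set (Fin d → ℝ)} {u v : Fin d → ℝ}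

namespace IsBadPair

/-- If `u` saves a step towards `a` and `b`, and `v` towards `a` and the facet opposite to `b`, then
`v` is at distance one from the latter. In the plane through `v` spanned by the two directions,
`P` contains the two corners of the square on the side `a`. A walk from `v` to the side `a` ends
in that plane, hence at one of these corners, and it changes the other coordinate by at most
one. -/
theorem height_opp_eq_one (h : IsBadPair k J P u v) {a b : Side d} (ha : a.1 ∈ J) (hb : b.1 ∈ J)
    (hab : a.1 ≠ b.1) (hu : SavesPair k P u a b) (hv : Saves k P v a b.opp) :
    height k b.opp v = 1 := by
  have hk := h.three_le_cast
  obtain ⟨mu, wu, hru, hsu⟩ := id hu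
  obtain ⟨m, w, hr, haw, hbw⟩ := id hv
  have hsw : height k a w + height k b.opp w ≤ height k a v + height k b.opp v - m - 1 := by
    linarith
  -- the corner of the square where `b` is attained
  obtain ⟨vp, vpa, vpb, np, hnp, hrp⟩ := h.exists_reach_corner ha hb hab hu h.right_mem
  -- the corner of the square where the facet opposite to `b` is attained
  obtain ⟨vm, vma, vmb, nm, hnm, hrm⟩ := h.symm.exists_reach_corner (b := b.opp) ha hb hab
    hv.savesPair hr.right_mem
  -- the end of a walk to the side `a`
  obtain ⟨v', va, n, hn, hrn⟩ := h.exists_reach_side ha h.right_mem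
  have hvp : ∀ l ∈ J, a.1 ≠ l → b.1 ≠ l → vp l = v l := by
    intro l hl hal hbl
    by_contra hne
    obtain ⟨e, rfl, he⟩ := h.box.exists_height_le_sub_one h.right_mem hrp.right_mem hne
    have e0 := h.eq_of_savesPair ha hb hab hru hsu hl hal hbl
    rw [← height_eq_iff (k := k)] at e0
    have e1 := h.le_three_sides ha hb hl hab hal hbl hru hrp
    linarith
  have hvm : ∀ l ∈ J, a.1 ≠ l → b.1 ≠ l → vm l = v l := by
    intro l hl hal hbl
    refine h.symm.eq_of_savesPair (b := b.opp) ha hb hab (hr.trans hrm) ?_ hl hal hbl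
    push_cast
    linarith
  have e1 := h.le_two_sides ha hb hab hru hrn
  have e2 := h.symm.le_two_sides ha (b := b.opp) hb hab hrn (.refl 0 h.left_mem)
  have hv' : ∀ l ∈ J, a.1 ≠ l → b.1 ≠ l → v' l = v l := by
    intro l hl hal hbl
    by_contra hne
    obtain ⟨e, rfl, he⟩ := h.box.exists_height_le_sub_one h.right_mem hrn.right_mem hne
    have e0 := h.eq_of_savesPair ha hb hab hru hsu hl hal hbl
    rw [← height_eq_iff (k := k)] at e0
    have e3 := h.le_three_sides ha hb hl hab hal hbl hru hrn
    have e4 := h.symm.le_three_sides ha (b := b.opp) hb hl hab hal hbl hrn (.refl 0 h.left_mem)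
    rw [height_opp, height_opp, height_opp] at e4
    push_cast at e4
    linarith
  have hX0 := h.box.height_nonneg b.opp hrn.right_mem.1
  have hX1 := h.box.height_nonneg b hrn.right_mem.1
  have hXw := h.box.height_nonneg b.opp hr.right_mem.1
  have hXv := h.box.height_nonneg b h.right_mem.1
  simp only [height_opp] at *
  push_cast at e1 e2
  -- an end strictly between the two corners would not be a vertex
  have hend : height k b v' = 0 ∨ height k b v' = k := by
    by_contra hcon
    push Not at hcon
    have h0 : 0 < height k b v' := lt_of_le_of_ne hX1 hcon.1.symm
    have h1 : height k b v' < k := lt_of_le_of_ne (by linarith) hcon.2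
    have hk0 : (0 : ℝ) < k := by linarith
    have hst : height k b v' / k + (1 - height k b v' / k) = 1 := by ring
    have := (h.box.eq_of_combo hrn.right_mem hrm.right_mem.1 hrp.right_mem.1
      (s := height k b v' / k) (t := 1 - height k b v' / k) (div_pos h0 hk0)
      (by rw [sub_pos, div_lt_one hk0]; exact h1) hst fun i hi => by
        by_cases hia : a.1 = i
        · subst hia
          exact coord_combo_of_height (k := k) hst (by rw [va, vma, vpa]; ring)
        by_cases hib : b.1 = i
        · subst hib
          refine coord_combo_of_height (k := k) hst ?_
          have : height k b vm = k := by linarith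
          rw [this, vpb]
          field_simp
          ring
        · rw [hvm i hi hia hib, hvp i hi hia hib, hv' i hi hia hib]; ring).1
    rw [← this] at h1
    linarith
  rcases hend with hend | hend
  · -- then `v` lies on the facet `b`, and `w` is in the triangle spanned by `v` and the corners
    exfalso
    have hbv : height k b v = 0 := by linarith
    have e3 := h.symm.le_two_sides ha (b := b.opp) hb hab hr (.refl 0 h.left_mem)
    have e4 := h.symm.le_one_side (a := b.opp) hb hr (.refl 0 h.left_mem)
    rw [height_opp, height_opp, height_opp] at e3
    rw [height_opp, height_opp, height_opp] at e4
    push_cast at e3 e4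
    have hbw' : height k b w = 1 := by linarith
    have hm1 : (1 : ℝ) ≤ m := by linarith
    have hα := h.box.height_nonneg a hr.right_mem.1
    have hαk := h.box.height_le a h.right_mem.1
    have hαpos : 0 < height k a v := by linarith
    set α := height k a v with hαdef
    have hk1 : (0 : ℝ) < k - 1 := by linarith
    set t : ℝ := (α - m) * k / (α * (k - 1)) with ht
    have ht0 : 0 ≤ t := by
      apply div_nonneg
      · exact mul_nonneg (by linarith) (by linarith)
      · exact (mul_pos hαpos hk1).le
    have ht1 : t ≤ 1 := by
      rw [ht, div_le_one (mul_pos hαpos hk1)]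
      nlinarith
    have hDP : t • v + (1 - t) • vp ∈ P :=
      h.box.convex h.right_mem.1 hrp.right_mem.1 ht0 (by linarith) (by ring)
    have hst : 1 / (k : ℝ) + (1 - 1 / k) = 1 := by ring
    have hk0 : (0 : ℝ) < k := by linarith
    have := (h.box.eq_of_combo hr.right_mem hrm.right_mem.1 hDP
      (s := 1 / k) (t := 1 - 1 / k) (by positivity)
      (by rw [sub_pos, div_lt_one hk0]; linarith) hst fun i hi => by
        by_cases hia : a.1 = i
        · subst hia
          refine coord_combo_of_height (k := k) hst ?_
          rw [height_combo a _ _ (by ring), vma, vpa, haw, ← hαdef, ht]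
          field_simp
          ring
        by_cases hib : b.1 = i
        · subst hib
          refine coord_combo_of_height (k := k) hst ?_
          rw [height_combo b _ _ (by ring), vpb, hbv, hbw']
          have : height k b vm = k := by linarith
          rw [this]
          field_simp
          ring
        · have e5 := h.symm.eq_of_savesPair (b := b.opp) ha hb hab hr
            (by rw [height_opp, height_opp]; linarith) hi hia hib
          simp only [Pi.add_apply, Pi.smul_apply, smul_eq_mul]
          rw [hvm i hi hia hib, hvp i hi hia hib, e5]; ring).1
    rw [← this] at hbw'
    linarith
  · linarith

/-- The vertices of a bad pair do not both save steps towards the same facet. -/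
theorem not_saves_and_saves (h : IsBadPair k J P u v) {a b c : Side d} (ha : a.1 ∈ J)
    (hb : b.1 ∈ J) (hc : c.1 ∈ J) (hab : a.1 ≠ b.1) (hac : a.1 ≠ c.1) (hu : Saves k P u a b)
    (hv : Saves k P v a c) : False := by
  have hk := h.three_le_cast
  obtain rfl := h.eq_opp_of_savesPair ha hb hc hab hac hu.savesPair hv.savesPair
  have hv1 := h.height_opp_eq_one ha hb hab hu.savesPair hv
  have hbadd := h.height_add hb
  have haadd := h.height_add ha
  rw [height_opp] at hv1
  -- `v` is far from `b`, so it saves a step towards `b`, necessarily away from `a`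
  obtain ⟨e, he, hbe, hve⟩ := h.symm.exists_saves hb (by linarith)
  obtain rfl := h.eq_opp_of_savesPair hb ha he hab.symm hbe hu.savesPair.swap hve.savesPair
  have h1 := h.height_opp_eq_one hb ha hab.symm hu.savesPair.swap hve
  -- `u` is far from the facet opposite to `b`, and saves a step towards it, also away from `a`
  obtain ⟨f, hf, hbf, huf⟩ := h.exists_saves (a := b.opp) hb (by rw [height_opp]; linarith)
  obtain rfl := h.symm.eq_opp_of_savesPair (a := b.opp) hb ha hf hab.symm hbf
    hv.savesPair.swap huf.savesPair
  have h2 := h.symm.height_opp_eq_one (a := b.opp) hb ha hab.symm hv.savesPair.swap huf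
  rw [height_opp] at h1 h2
  linarith

end IsBadPair

end Conflict

/-! ### Bad pairs do not exist -/

section Final

variable {d : ℕ} {k : ℕ} {J : Finset (Fin d)} {P : Set (Fin d → ℝ)} {u v : Fin d → ℝ}

theorem Finset.sum_le_one_of_pairwise {ι : Type*} (L : Finset ι) (f : ι → ℝ)
    (h0 : ∀ l ∈ L, 0 ≤ f l) (h1 : ∀ l ∈ L, f l ≤ 1) (hint : ∀ l ∈ L, f l ≠ 0 → 1 ≤ f l)
    (h2 : ∀ l ∈ L, ∀ m ∈ L, l ≠ m → f l + f m ≤ 1) : ∑ l ∈ L, f l ≤ 1 := by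
  by_cases hz : ∀ l ∈ L, f l = 0
  · rw [Finset.sum_eq_zero hz]; exact zero_le_one
  push Not at hz
  obtain ⟨l, hl, hne⟩ := hz
  rw [Finset.sum_eq_single_of_mem l hl fun m hm hml => ?_]
  · exact h1 l hl
  · linarith [h0 m hm, hint l hl hne, h2 l hl m hm hml.symm]

theorem IsBoxPolytope.one_le_height (hP : IsBoxPolytope k J P) {a : Side d}
    {x : Fin d → ℝ} (hx : x ∈ P.extremePoints ℝ) (h : height k a x ≠ 0) : 1 ≤ height k a x := by
  obtain ⟨n, -, hn⟩ := hP.exists_height_eq a hx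
  rw [hn] at h ⊢
  exact_mod_cast Nat.one_le_iff_ne_zero.2 (by exact_mod_cast h)

namespace IsBadPair

/-- In every direction, `u` is within distance one of one of the two facets, and the edges from `u`
towards this facet are parallel to the coordinate axis: `v` saves a step towards it, so `u` does
not. -/
theorem exists_near_sides (h : IsBadPair k J P u v) : ∃ s : Fin d → Side d,
    (∀ i, (s i).1 = i) ∧ ∀ i ∈ J, (height k (s i) u = 0 ∨ height k (s i) u = 1) ∧
      ∀ w, IsEdge P u w → height k (s i) w < height k (s i) u → ∀ j ∈ J, i ≠ j → w j = u j := by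
  have hk := h.three_le_cast
  suffices H : ∀ i : Fin d, ∃ a : Side d, a.1 = i ∧ (i ∈ J → (height k a u = 0 ∨ height k a u = 1) ∧
      ∀ w, IsEdge P u w → height k a w < height k a u → ∀ j ∈ J, i ≠ j → w j = u j) by
    choose s hs hs' using H
    exact ⟨s, hs, hs'⟩
  intro i
  by_cases hi : i ∈ J
  swap
  · exact ⟨(i, false), rfl, fun hi' => absurd hi' hi⟩
  have hfar : ∀ b : Side d, b.1 = i → 2 ≤ height k b u → 2 ≤ height k b v → False := by
    rintro b rfl h1 h2
    obtain ⟨c, hc, hbc, huc⟩ := h.exists_saves hi h1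
    obtain ⟨e, he, hbe, hve⟩ := h.symm.exists_saves hi h2
    exact h.not_saves_and_saves hi hc he hbc hbe huc hve
  have hnear : ∃ a : Side d, a.1 = i ∧ (height k a u = 0 ∨ height k a u = 1) := by
    have key : ∀ b : Side d, height k b u < 2 → height k b u = 0 ∨ height k b u = 1 := by
      intro b hb
      obtain ⟨n, -, hn⟩ := h.box.exists_height_eq b h.left_mem
      rw [hn] at hb ⊢
      have : n < 2 := by exact_mod_cast hb
      interval_cases n <;> simp
    by_cases h1 : height k (i, false) u < 2
    · exact ⟨_, rfl, key _ h1⟩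
    by_cases h2 : height k (i, true) u < 2
    · exact ⟨_, rfl, key _ h2⟩
    exfalso
    have e := h.height_add (a := (i, false)) hi
    refine hfar (i, false) rfl (not_lt.1 h1) ?_
    simp only [height, Bool.false_eq_true, if_false, if_true] at e h2 ⊢
    linarith
  obtain ⟨a, rfl, hau⟩ := hnear
  refine ⟨a, rfl, fun _ => ⟨hau, fun w hw hlt => ?_⟩⟩
  have hsum := h.height_add hi
  have hle := h.le_one_side hi (.of_isEdge hw) (.refl 0 h.right_mem)
  have hle' := h.box.height_le_sub_one hw.left_mem hw.right_mem hlt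
  push_cast at hle
  obtain ⟨c, hc, hac, hvc⟩ := h.symm.exists_saves hi (by rcases hau with e | e <;> linarith)
  rcases h.saves_or_eq hw (by linarith) with ⟨b, hb, hab, hub⟩ | hpure
  · exact (h.not_saves_and_saves hi hb hc hab hac hub hvc).elim
  · exact hpure

/-- A walk from `u` to the far facet in the direction `i` leaves the near facets of the directions
in `L` by at most one unit altogether. Hence the height `z_i` above the near facet, minus the sum
of the `z_l` for `l ∈ L`, cannot have a local maximum, at a vertex, with value at most one. -/
theorem false_of_local_max (h : IsBadPair k J P u v) {s : Fin d → Side d} (hs : ∀ i, (s i).1 = i)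
    {i : Fin d} (hi : i ∈ J) {L : Finset (Fin d)} (hL : L ⊆ J.erase i)
    (hLu : ∀ l ∈ L, height k (s l) u = 0) {x : Fin d → ℝ} (hx : x ∈ P.extremePoints ℝ)
    (hx1 : height k (s i) x - ∑ l ∈ L, height k (s l) x ≤ 1)
    (hmax : ∀ w, IsEdge P x w → height k (s i) w - ∑ l ∈ L, height k (s l) w ≤
      height k (s i) x - ∑ l ∈ L, height k (s l) x) : False := by
  have hk := h.three_le_cast
  have hLJ : ∀ l ∈ L, i ≠ l ∧ l ∈ J := fun l hl =>
    ⟨(Finset.mem_erase.1 (hL hl)).1.symm, (Finset.mem_erase.1 (hL hl)).2⟩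
  have hsJ : ∀ j, j ∈ J → (s j).1 ∈ J := fun j hj => (hs j).symm ▸ hj
  have hsne : ∀ j l, j ≠ l → (s j).1 ≠ (s l).1 := fun j l hjl => by rwa [hs, hs]
  obtain ⟨u', hu'0, n, hn, hr⟩ := h.exists_reach_side (a := (s i).opp) (hsJ i hi) h.left_mem
  rw [height_opp] at hu'0 hn
  have hsum : ∑ l ∈ L, height k (s l) u' ≤ 1 := by
    refine Finset.sum_le_one_of_pairwise L _ (fun l _ => h.box.height_nonneg _ hr.right_mem.1)
      (fun l hl => ?_) (fun l _ => h.box.one_le_height hr.right_mem) (fun l hl m hm hlm => ?_)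
    · obtain ⟨hil, hlJ⟩ := hLJ l hl
      have e := h.le_two_sides (a := (s i).opp) (b := (s l).opp) (hsJ i hi) (hsJ l hlJ)
        (hsne i l hil) hr (.refl 0 h.right_mem)
      simp only [height_opp] at e
      rw [hLu l hl] at e
      push_cast at e
      linarith
    · obtain ⟨hil, hlJ⟩ := hLJ l hl
      obtain ⟨him, hmJ⟩ := hLJ m hm
      have e := h.le_three_sides (a := (s i).opp) (b := (s l).opp) (c := (s m).opp) (hsJ i hi)
        (hsJ l hlJ) (hsJ m hmJ) (hsne i l hil) (hsne i m him) (hsne l m hlm) hr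
        (.refl 0 h.right_mem)
      simp only [height_opp] at e
      rw [hLu l hl, hLu m hm] at e
      push_cast at e
      linarith
  have hval : ∀ y, (∑ l ∈ L, sideForm (s l) - sideForm (s i)) y =
      -(height k (s i) y - ∑ l ∈ L, height k (s l) y) +
        ((if (s i).2 then (k : ℝ) else 0) - ∑ l ∈ L, if (s l).2 then (k : ℝ) else 0) := by
    intro y
    have : (∑ l ∈ L, sideForm (s l) - sideForm (s i)) y =
        (∑ l ∈ L, sideForm (s l)) y - sideForm (s i) y := rfl
    rw [this, sum_apply, sideForm_eq k,
      Finset.sum_congr rfl fun l _ => sideForm_eq k (s l) y, Finset.sum_sub_distrib]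
    ring
  obtain ⟨w, hw, hlt⟩ := h.box.isPolytope.exists_isEdge_lt hx
    (c := ∑ l ∈ L, sideForm (s l) - sideForm (s i)) hr.right_mem.1 (by
      rw [hval, hval]; linarith)
  rw [hval, hval] at hlt
  linarith [hmax w hw]

/-- If `u` lies at distance one from its near facet in the direction `i`, then `z_i - ∑ z_l`, the sum
over the directions in which `u` lies on its near facet, has a local maximum at `u`. -/
theorem height_near_ne_one (h : IsBadPair k J P u v) {s : Fin d → Side d} (hs : ∀ i, (s i).1 = i)
    (hs01 : ∀ i ∈ J, height k (s i) u = 0 ∨ height k (s i) u = 1)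
    (hpure : ∀ i ∈ J, ∀ w, IsEdge P u w → height k (s i) w < height k (s i) u →
      ∀ j ∈ J, i ≠ j → w j = u j) {i : Fin d} (hi : i ∈ J) : height k (s i) u ≠ 1 := by
  intro hi1
  have hsJ : ∀ j, j ∈ J → (s j).1 ∈ J := fun j hj => (hs j).symm ▸ hj
  have hsne : ∀ j l, j ≠ l → (s j).1 ≠ (s l).1 := fun j l hjl => by rwa [hs, hs]
  have hcoord : ∀ j (x y : Fin d → ℝ), height k (s j) x = height k (s j) y ↔ x j = y j := by
    intro j x y
    rw [height_eq_iff, hs]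
  have hcombo : ∀ j (w x y : Fin d → ℝ) (p q : ℝ), p + q = 1 →
      height k (s j) w = p * height k (s j) x + q * height k (s j) y → w j = p * x j + q * y j := by
    intro j w x y p q hpq e
    have := coord_combo_of_height hpq e
    rwa [hs] at this
  -- the neighbor of `u` on a near facet
  have hdown : ∀ j ∈ J, height k (s j) u = 1 → ∃ y, IsEdge P u y ∧ height k (s j) y = 0 ∧
      ∀ l ∈ J, j ≠ l → y l = u l := by
    intro j hj hj1
    obtain ⟨y, hy, hyj⟩ := h.exists_isEdge_height (a := s j) (hsJ j hj) (.refl 0 h.left_mem)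
      (by simp) (by linarith)
    exact ⟨y, hy, by linarith, hpure j hj y hy (by linarith)⟩
  obtain ⟨u₁, hu₁, hu₁i, hu₁p⟩ := hdown i hi hi1
  set L := (J.erase i).filter (fun l => height k (s l) u = 0) with hLdef
  have hLu : ∀ l ∈ L, height k (s l) u = 0 := fun l hl => (Finset.mem_filter.1 hl).2
  have hsum0 : ∑ l ∈ L, height k (s l) u = 0 := Finset.sum_eq_zero hLu
  refine h.false_of_local_max hs hi (Finset.filter_subset _ _) hLu h.left_mem
    (by rw [hsum0, hi1]; simp) fun w hw => ?_
  rw [hsum0, hi1]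
  have hup : ∀ j ∈ J, height k (s j) w ≤ height k (s j) u + 1 := by
    intro j hj
    have e := h.le_one_side (a := (s j).opp) (hsJ j hj) (.of_isEdge hw) (.refl 0 h.right_mem)
    rw [height_opp, height_opp, height_opp] at e
    push_cast at e
    linarith
  have hnn : ∀ l ∈ L, 0 ≤ height k (s l) w := fun l _ => h.box.height_nonneg _ hw.right_mem.1
  by_cases hwi : height k (s i) w ≤ 1
  · linarith [Finset.sum_nonneg hnn]
  by_cases hwL : ∃ l ∈ L, height k (s l) w ≠ 0
  · obtain ⟨l, hl, hne⟩ := hwL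
    have e1 := h.box.one_le_height hw.right_mem hne
    have e2 := Finset.single_le_sum (f := fun l => height k (s l) w) hnn hl
    have e3 := hup i hi
    linarith
  exfalso
  push Not at hwi hwL
  have hwi2 : height k (s i) w = 2 := by
    have e1 := hup i hi
    have e2 := h.box.height_le_sub_one (a := s i) hw.right_mem hw.left_mem (by linarith)
    linarith
  by_cases hall : ∀ j ∈ J, i ≠ j → w j = u j
  · -- `u` is the midpoint of `u₁` and `w`
    have := (h.box.eq_of_combo h.left_mem hu₁.right_mem.1 hw.right_mem.1 (s := 1 / 2) (t := 1 / 2)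
      (by norm_num) (by norm_num) (by norm_num) fun j hj => by
        by_cases hij : i = j
        · subst hij
          exact hcombo i _ _ _ _ _ (by norm_num) (by rw [hi1, hu₁i, hwi2]; norm_num)
        · rw [hu₁p j hj hij, hall j hj hij]; ring).2
    exact hw.ne this.symm
  push Not at hall
  obtain ⟨j, hj, hij, hne⟩ := hall
  have hju : height k (s j) u = 1 := by
    rcases hs01 j hj with e | e
    · exfalso
      refine hne ((hcoord j w u).1 ?_)
      rw [e]
      exact hwL j (Finset.mem_filter.2 ⟨Finset.mem_erase.2 ⟨hij.symm, hj⟩, e⟩)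
    · exact e
  have hjw : height k (s j) w = 2 := by
    have e1 := hup j hj
    rcases lt_trichotomy (height k (s j) w) (height k (s j) u) with e | e | e
    · have := (hcoord i w u).2 (hpure j hj w hw e i hi hij.symm)
      linarith
    · exact absurd ((hcoord j w u).1 e) hne
    · have := h.box.height_le_sub_one hw.right_mem hw.left_mem e
      linarith
  obtain ⟨u₂, hu₂, hu₂j, hu₂p⟩ := hdown j hj hju
  -- `u` is the barycenter of `u₁`, `u₂` and `w`
  have hmid : (1 / 2 : ℝ) • u₁ + (1 / 2 : ℝ) • u₂ ∈ P :=
    h.box.convex hu₁.right_mem.1 hu₂.right_mem.1 (by norm_num) (by norm_num) (by norm_num)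
  have := (h.box.eq_of_combo h.left_mem hw.right_mem.1 hmid (s := 1 / 3) (t := 2 / 3)
    (by norm_num) (by norm_num) (by norm_num) fun l hl => by
      by_cases hil : i = l
      · subst hil
        refine hcombo i _ _ _ _ _ (by norm_num) ?_
        rw [height_combo _ _ _ (by norm_num), (hcoord i u₂ u).2 (hu₂p i hi hij.symm), hi1, hu₁i,
          hwi2]
        norm_num
      by_cases hjl : j = l
      · subst hjl
        refine hcombo j _ _ _ _ _ (by norm_num) ?_
        rw [height_combo _ _ _ (by norm_num), (hcoord j u₁ u).2 (hu₁p j hj hij), hju, hu₂j, hjw]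
        norm_num
      · have e := h.eq_of_savesPair (a := (s i).opp) (b := (s j).opp) (hsJ i hi) (hsJ j hj)
          (hsne i j hij) (.of_isEdge hw) (by
            rw [height_opp, height_opp, height_opp, height_opp, hi1, hju, hwi2, hjw]
            push_cast
            linarith) hl (by rw [Side.opp_fst, hs]; exact hil) (by rw [Side.opp_fst, hs]; exact hjl)
        simp only [Pi.add_apply, Pi.smul_apply, smul_eq_mul]
        rw [e, hu₁p l hl hil, hu₂p l hl hjl]; ring).1
  exact hw.ne this.symm

/-- By `height_near_ne_one`, the vertex `u` lies on all its near facets. -/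
theorem false (h : IsBadPair k J P u v) : False := by
  have hne : J.Nonempty := by
    by_contra hJ
    rw [Finset.not_nonempty_iff_eq_empty] at hJ
    have huv : u = v := h.box.eq_of_eqOn u h.left_mem.1 v h.right_mem.1 (by simp [hJ])
    exact h.not_reach (huv ▸ .refl _ h.left_mem)
  obtain ⟨i, hi⟩ := hne
  obtain ⟨s, hs, hnear⟩ := h.exists_near_sides
  have hu0 : ∀ j ∈ J, height k (s j) u = 0 := fun j hj =>
    (hnear j hj).1.resolve_right
      (h.height_near_ne_one hs (fun i hi => (hnear i hi).1) (fun i hi => (hnear i hi).2) hj)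
  have hsJ : (s i).1 ∈ J := (hs i).symm ▸ hi
  have hLu : ∀ l ∈ J.erase i, height k (s l) u = 0 := fun l hl => hu0 l (Finset.mem_of_mem_erase hl)
  have hup : ∀ (m : ℕ) w, Reach P m u w → height k (s i) w ≤ m := by
    intro m w hw
    have e := h.le_one_side (a := (s i).opp) hsJ hw (.refl 0 h.right_mem)
    rw [height_opp, height_opp, height_opp, hu0 i hi] at e
    push_cast at e
    linarith
  have hnn : ∀ w ∈ P.extremePoints ℝ, ∀ l ∈ J.erase i, 0 ≤ height k (s l) w :=
    fun w hw l _ => h.box.height_nonneg _ hw.1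
  have hge : ∀ w ∈ P.extremePoints ℝ, (∃ j ∈ J.erase i, height k (s j) w ≠ 0) →
      1 ≤ ∑ l ∈ J.erase i, height k (s l) w := by
    rintro w hw ⟨j, hj, hne⟩
    exact (h.box.one_le_height hw hne).trans
      (Finset.single_le_sum (f := fun l => height k (s l) w) (hnn w hw) hj)
  -- `z_i` minus the sum of the other heights has a local maximum either at `u` or at the neighbor
  -- of `u` in the direction `i`
  by_cases hx : ∃ x, IsEdge P u x ∧ height k (s i) x = 1 ∧ ∀ j ∈ J.erase i, height k (s j) x = 0
  · obtain ⟨x, hux, hxi, hx0⟩ := hx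
    have hsum0 : ∑ l ∈ J.erase i, height k (s l) x = 0 := Finset.sum_eq_zero hx0
    refine h.false_of_local_max hs hi (Finset.Subset.refl _) hLu hux.right_mem
      (by rw [hsum0, hxi]; simp) fun w hw => ?_
    rw [hsum0, hxi]
    have hw2 := hup 2 w ((Reach.of_isEdge hux).trans (.of_isEdge hw))
    push_cast at hw2
    by_cases hwi : height k (s i) w ≤ 1
    · linarith [Finset.sum_nonneg (hnn w hw.right_mem)]
    by_cases hwL : ∃ j ∈ J.erase i, height k (s j) w ≠ 0
    · linarith [hge w hw.right_mem hwL]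
    exfalso
    push Not at hwi hwL
    have := h.box.height_le_sub_one (a := s i) hw.right_mem hux.right_mem (by linarith)
    have := (h.box.eq_of_combo hux.right_mem h.left_mem.1 hw.right_mem.1 (s := 1 / 2) (t := 1 / 2)
      (by norm_num) (by norm_num) (by norm_num) fun j hj => by
        have e : height k (s j) x = 1 / 2 * height k (s j) u + 1 / 2 * height k (s j) w := by
          by_cases hij : j = i
          · subst hij
            rw [hxi, hu0 j hj]; linarith
          · have hj' := Finset.mem_erase.2 ⟨hij, hj⟩
            rw [hx0 j hj', hu0 j hj, hwL j hj']; norm_num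
        have := coord_combo_of_height (by norm_num) e
        rwa [hs] at this).1
    exact hux.ne this
  · have hsum0 : ∑ l ∈ J.erase i, height k (s l) u = 0 := Finset.sum_eq_zero hLu
    refine h.false_of_local_max hs hi (Finset.Subset.refl _) hLu h.left_mem
      (by rw [hsum0, hu0 i hi]; simp) fun w hw => ?_
    rw [hsum0, hu0 i hi]
    have hw1 := hup 1 w (.of_isEdge hw)
    push_cast at hw1
    by_cases hwi : height k (s i) w = 0
    · linarith [Finset.sum_nonneg (hnn w hw.right_mem)]
    have hwi1 := h.box.one_le_height hw.right_mem hwi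
    have := hge w hw.right_mem (by
      by_contra hcon
      push Not at hcon
      exact hx ⟨w, hw, by linarith, hcon⟩)
    linarith

end IsBadPair

/-- The bound on the distance of two vertices, by induction on the number of coordinates needed to
determine a point of `P`. -/
theorem IsBoxPolytope.reach_diamBound (hk : 3 ≤ k) (hP : IsBoxPolytope k J P)
    (hu : u ∈ P.extremePoints ℝ) (hv : v ∈ P.extremePoints ℝ) :
    Reach P (diamBound k J.card) u v := by
  induction hn : J.card using Nat.strong_induction_on generalizing J P u v with
  | _ n ih =>
  subst hn
  by_contra hcon
  exact IsBadPair.false ⟨hk, hP, hu, hv,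
    fun J' Q hlt hQ x hx y hy => ih J'.card hlt hQ hx hy rfl, hcon⟩

end Final

/-! ### The diameter of lattice polytopes -/

theorem IsLatticeDKPolytope.isBoxPolytope {d k : ℕ} {P : Set (Fin d → ℝ)}
    (hP : IsLatticeDKPolytope d k P) : IsBoxPolytope k Finset.univ P := by
  obtain ⟨⟨S, rfl⟩, hlat⟩ := hP
  refine ⟨(S.finite_toSet.image _).isCompact_convexHull ℝ, convex_convexHull ℝ _,
    fun v hv i => ?_, fun x _ y _ h => funext fun i => h i (Finset.mem_univ i)⟩
  obtain ⟨z, hz, rfl⟩ := hlat v hv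
  exact ⟨z i, hz i, rfl⟩

theorem Reach.edist_le {d n : ℕ} {P : Set (Fin d → ℝ)} {x y : Fin d → ℝ} (h : Reach P n x y)
    (hx : x ∈ P.extremePoints ℝ) (hy : y ∈ P.extremePoints ℝ) :
    (polytopeGraph P).edist ⟨x, hx⟩ ⟨y, hy⟩ ≤ n := by
  induction h with
  | refl n _ => simp
  | @step n x y z h _ ih =>
    have hadj : (polytopeGraph P).Adj ⟨x, hx⟩ ⟨y, h.right_mem⟩ :=
      ⟨fun e => h.ne (congrArg Subtype.val e), h.isExtreme⟩
    calc (polytopeGraph P).edist ⟨x, hx⟩ ⟨z, hy⟩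
        ≤ (polytopeGraph P).edist ⟨x, hx⟩ ⟨y, h.right_mem⟩ +
          (polytopeGraph P).edist ⟨y, h.right_mem⟩ ⟨z, hy⟩ := SimpleGraph.edist_triangle
      _ ≤ 1 + n := add_le_add (SimpleGraph.edist_eq_one_iff_adj.2 hadj).le (ih h.right_mem hy)
      _ = ((n + 1 : ℕ) : ℕ∞) := by push_cast; rw [add_comm]

/-- `δ(d,k) ≤ kd - ⌈2d/3⌉` for `k ≥ 3`, written without subtraction in `ℕ∞`. -/
theorem theorem1 (d k : ℕ) (hk : 3 ≤ k) :
    latticePolytopeDiam d k + (⌈(2 * (d : ℚ) / 3)⌉₊ : ℕ∞) ≤ ((k * d : ℕ) : ℕ∞) := by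
  have hceil : ⌈(2 * (d : ℚ) / 3)⌉₊ ≤ (2 * d + 2) / 3 := by
    have hd : 2 * d ≤ 3 * ((2 * d + 2) / 3) := by omega
    have hd' : (2 * d : ℚ) ≤ 3 * ((2 * d + 2) / 3 : ℕ) := by exact_mod_cast hd
    rw [Nat.ceil_le, div_le_iff₀ (by norm_num)]
    linarith
  have hdiam : latticePolytopeDiam d k ≤ (diamBound k d : ℕ∞) := by
    refine iSup₂_le fun P hP => SimpleGraph.ediam_le_of_edist_le fun x y => ?_
    have := (hP.isBoxPolytope.reach_diamBound hk x.2 y.2).edist_le x.2 y.2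
    rwa [Finset.card_univ, Fintype.card_fin] at this
  calc latticePolytopeDiam d k + (⌈(2 * (d : ℚ) / 3)⌉₊ : ℕ∞)
      ≤ (diamBound k d : ℕ∞) + ((2 * d + 2) / 3 : ℕ) :=
        add_le_add hdiam (by exact_mod_cast hceil)
    _ = ((k * d : ℕ) : ℕ∞) := by
        rw [← diamBound_add hk d]; push_cast; rfl
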